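/- **Theorem (stability of hand-eye calibration).** Fix $T\in\mathbb N$. Let $\theta$ be the vector of all egomotion measurements $R_{a_t},R_{b_t}\in\mathbb R^{3\times3}$, $t_{a_t},t_{b_t}\in\mathbb R^3$ ($t=1,\dots,T$), with the Euclidean norm; the entries of $\theta$ are arbitrary real numbers. For $R\in\mathbb R^{3\times 3}$, $\tau\in\mathbb R^3$, $\alpha\in\mathbb R$ put $$f_\theta(R,\tau,\alpha)=\sum_{t=1}^T\|R\,t_{a_t}+\tau-R_{b_t}\tau-\alpha\,t_{b_t}\|_2^2+\sum_{t=1}^T\|R R_{a_t}-R_{b_t}R\|_F^2=x^{\mathsf T}Q_\theta x,\qquad x=(\tau,\alpha,\operatorname{vec}R).$$ The *known-scale problem* is to minimize $f_\theta(R,\tau,1)$ over $R\in O(3)$, $\tau\in\mathbb R^3$. The *unknown-scale problem* is to minimize $f_\theta(R,\tau,\alpha)$ over $R\in O(3)$, $\tau\in\mathbb R^3$, $\alpha\in\mathbb R$. Their Lagrangian duals, for the constraint $RR^{\mathsf T}=I$ with symmetric multiplier $\Lambda\in\mathbb R^{3\times3}$, are the semidefinite programs $$\max_{\gamma,\Lambda}\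 \gamma\ \text{ s.t. } Z_\theta(\gamma,\Lambda)=Q_\theta+\operatorname{diag}\bigl(0,\ \operatorname{tr}\Lambda-\gamma,\ -I\otimes\Lambda\bigr)\succeq0,\qquad \max_{\Lambda}\ \operatorname{tr}\Lambda\ \text{ s.t. } Z_\theta(\Lambda)=Q_\theta+\operatorname{diag}\bigl(0,0,-I\otimes\Lambda\bigr)\succeq0,$$ where the diagonal blocks belong to $\tau$, to the scalar coordinate, and to $\operatorname{vec}R$. In the known-scale dual the scalar coordinate is a homogenizing variable $y$ in place of $\alpha$. Let $\bar\theta$ be noise-free with ground truth $R\in SO(3)$, $\tau\in\mathbb R^3$: for every $t$, the measured $R_{a_t},R_{b_t}$ are in $SO(3)$, $R_{b_t}R=RR_{a_t}$, and $R_{b_t}\tau+t_{b_t}=R\,t_{a_t}+\tau$. Suppose that there are indices $i,j$ such that, for $\bar\theta$, * $R_{b_i}\ne I$ and $R_{b_j}\ne I$ have distinct rotation axes; * $R_{b_i}$ and $R_{b_j}$ are not both rotations by the angle $\pi$, and if one of them is, then the two axes are not perpendicular; * $\begin{bmatrix}R\,t_{a_i}\\ R\,t_{a_j}\end{bmatrix}$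 is not in the column span of $\begin{bmatrix}I-R_{b_i}\\ I-R_{b_j}\end{bmatrix}$. Then there is $\varepsilon>0$ such that for every $\theta$ with $\|\theta-\bar\theta\|\le\varepsilon$ the following hold. 1. *Strong duality.* For the known-scale problem, and likewise for the unknown-scale problem, the primal and the dual optimal value are attained and equal. 2. *Recovery.* For every optimal solution of the known-scale dual, the dual matrix $Z$ has a nonzero null vector, and each nonzero null vector $(\sigma,y,\operatorname{vec}S)$ has $y\neq0$ and gives a global minimizer $(S/y,\sigma/y)$ of the known-scale problem. For every optimal solution of the unknown-scale dual, the null space of $Z$ is one-dimensional, and for each nonzero null vector $(\sigma,\beta,\operatorname{vec}S)$ there is $c>0$ such that $(S/c,\sigma/c,\beta/c)$ is a global minimizer of the unknown-scale problem. -/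

import Mathlib

open scoped Matrix Kronecker

namespace HandEye

/-- Real `3 × 3` matrices. -/
abbrev Mat3 := Matrix (Fin 3) (Fin 3) ℝ

/-- Vectors of `ℝ³`, in coordinates. -/
abbrev Vec3 := Fin 3 → ℝ

/-- The vector of all egomotion measurements of `T` time steps, with its Euclidean norm. At each
time step it lists the entries of `R_a` and of `R_b`, then those of `t_a` and of `t_b`. The entries
are arbitrary reals: noisy "rotations" are not required to be rotations. -/
abbrev Measurements (T : ℕ) :=
  EuclideanSpace ℝ (Fin T × ((Fin 3 × Fin 3) ⊕ (Fin 3 × Fin 3) ⊕ Fin 3 ⊕ Fin 3))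

variable {T : ℕ}

/-- Measured incremental rotation `R_{a_t}` of sensor `a`. -/
def rotA (θ : Measurements T) (t : Fin T) : Mat3 :=
  Matrix.of fun i j => θ (t, Sum.inl (i, j))

/-- Measured incremental rotation `R_{b_t}` of sensor `b`. -/
def rotB (θ : Measurements T) (t : Fin T) : Mat3 :=
  Matrix.of fun i j => θ (t, Sum.inr (Sum.inl (i, j)))

/-- Measured incremental translation `t_{a_t}` of sensor `a`. -/
def trA (θ : Measurements T) (t : Fin T) : Vec3 :=
  fun i => θ (t, Sum.inr (Sum.inr (Sum.inl i)))

/-- Measured incremental translation `t_{b_t}` of sensor `b`. -/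
def trB (θ : Measurements T) (t : Fin T) : Vec3 :=
  fun i => θ (t, Sum.inr (Sum.inr (Sum.inr i)))

/-! ### The primal problems -/

/-- The rotation cost `J_R = ∑ₜ ‖R R_{a_t} - R_{b_t} R‖_F²`. -/
def rotCost (θ : Measurements T) (R : Mat3) : ℝ :=
  ∑ t, ∑ i, ∑ j, ((R * rotA θ t - rotB θ t * R) i j) ^ 2

/-- The translation cost `∑ₜ ‖R t_{a_t} + τ - R_{b_t} τ - α t_{b_t}‖₂²`. -/
def trCost (θ : Measurements T) (R : Mat3) (τ : Vec3) (α : ℝ) : ℝ :=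
  ∑ t, ∑ i, ((R *ᵥ trA θ t + τ - rotB θ t *ᵥ τ - α • trB θ t) i) ^ 2

/-- The total cost; the known-scale cost is the one at `α = 1`. -/
def cost (θ : Measurements T) (R : Mat3) (τ : Vec3) (α : ℝ) : ℝ :=
  trCost θ R τ α + rotCost θ R

/-- `(R, τ)` is a global minimizer of the known-scale problem: minimize `cost θ R τ 1` over
`R ∈ O(3)`, `τ ∈ ℝ³`. -/
def IsOptimalKnown (θ : Measurements T) (R : Mat3) (τ : Vec3) : Prop :=
  R ∈ Matrix.orthogonalGroup (Fin 3) ℝ ∧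
    ∀ R' ∈ Matrix.orthogonalGroup (Fin 3) ℝ, ∀ τ' : Vec3, cost θ R τ 1 ≤ cost θ R' τ' 1

/-- `(R, τ, α)` is a global minimizer of the unknown-scale problem: minimize `cost θ R τ α` over
`R ∈ O(3)`, `τ ∈ ℝ³`, `α ∈ ℝ`. -/
def IsOptimalUnknown (θ : Measurements T) (R : Mat3) (τ : Vec3) (α : ℝ) : Prop :=
  R ∈ Matrix.orthogonalGroup (Fin 3) ℝ ∧
    ∀ R' ∈ Matrix.orthogonalGroup (Fin 3) ℝ, ∀ (τ' : Vec3) (α' : ℝ),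
      cost θ R τ α ≤ cost θ R' τ' α'

/-! ### The dual semidefinite programs -/

/-- Index type of the state `x = (τ, s, vec R)`. The scalar `s` is the scale `α` in the
unknown-scale problem and the homogenizing variable `y` in the known-scale problem. As in
`Matrix.vec`, the pair `(j, i)` indexes the entry in row `i` and column `j` of `R`. -/
abbrev StateIdx := Fin 3 ⊕ Unit ⊕ (Fin 3 × Fin 3)

/-- The translation block of a state. -/
def stateTr (x : StateIdx → ℝ) : Vec3 := fun i => x (Sum.inl i)

/-- The scalar block of a state. -/
def stateScalar (x : StateIdx → ℝ) : ℝ := x (Sum.inr (Sum.inl ()))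

/-- The matrix whose columns are stacked in the last block of a state. -/
def stateMat (x : StateIdx → ℝ) : Mat3 := Matrix.of fun i j => x (Sum.inr (Sum.inr (j, i)))

/-- `M_{R_t} = [0  0  R_{a_t}ᵀ ⊗ I - I ⊗ R_{b_t}]`, mapping `x` to `vec (R R_{a_t} - R_{b_t} R)`. -/
def rotResidual (θ : Measurements T) (t : Fin T) : Matrix (Fin 3 × Fin 3) StateIdx ℝ :=
  Matrix.fromCols 0 (Matrix.fromCols 0
    ((rotA θ t)ᵀ ⊗ₖ (1 : Mat3) - (1 : Mat3) ⊗ₖ rotB θ t))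

/-- `M_{t α_t} = [I - R_{b_t}  -t_{b_t}  t_{a_t}ᵀ ⊗ I]`, mapping `x` to
`R t_{a_t} + τ - R_{b_t} τ - s t_{b_t}`. -/
def trResidual (θ : Measurements T) (t : Fin T) : Matrix (Fin 3) StateIdx ℝ :=
  Matrix.fromCols (1 - rotB θ t) (Matrix.fromCols (Matrix.of fun i _ => -trB θ t i)
    (Matrix.of fun i p => trA θ t p.1 * (1 : Mat3) i p.2))

/-- The cost matrix `Q`, with `xᵀ Q x = cost θ R τ s` for `x = (τ, s, vec R)`. -/
def costMatrix (θ : Measurements T) : Matrix StateIdx StateIdx ℝ :=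
  ∑ t, ((rotResidual θ t)ᵀ * rotResidual θ t + (trResidual θ t)ᵀ * trResidual θ t)

/-- The matrix of the quadratic form `x ↦ c s² - tr (Λ R Rᵀ)`. -/
def multiplierMatrix (c : ℝ) (Λ : Mat3) : Matrix StateIdx StateIdx ℝ :=
  Matrix.fromBlocks 0 0 0 (Matrix.fromBlocks (c • 1) 0 0 (-((1 : Mat3) ⊗ₖ Λ)))

/-- Dual matrix of the known-scale problem. The constraints, homogenized by `y`, are
`y² I - R Rᵀ = 0` (multiplier `Λ`) and `1 - y² = 0` (multiplier `γ`), so that the Lagrangian is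
`γ + xᵀ Z x` for `x = (τ, y, vec R)`. -/
def dualMatrixKnown (θ : Measurements T) (γ : ℝ) (Λ : Mat3) : Matrix StateIdx StateIdx ℝ :=
  costMatrix θ + multiplierMatrix (Λ.trace - γ) Λ

/-- Feasibility for the dual SDP of the known-scale problem. -/
def IsDualFeasibleKnown (θ : Measurements T) (γ : ℝ) (Λ : Mat3) : Prop :=
  Λ.IsSymm ∧ (dualMatrixKnown θ γ Λ).PosSemidef

/-- Optimality for the dual SDP of the known-scale problem: maximize `γ`. -/
def IsDualOptimalKnown (θ : Measurements T) (γ : ℝ) (Λ : Mat3) : Prop :=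
  IsDualFeasibleKnown θ γ Λ ∧ ∀ γ' Λ', IsDualFeasibleKnown θ γ' Λ' → γ' ≤ γ

/-- Dual matrix of the unknown-scale problem. The constraint is `I - R Rᵀ = 0` (multiplier `Λ`),
so that the Lagrangian is `tr Λ + xᵀ Z x` for `x = (τ, α, vec R)`. -/
def dualMatrixUnknown (θ : Measurements T) (Λ : Mat3) : Matrix StateIdx StateIdx ℝ :=
  costMatrix θ + multiplierMatrix 0 Λ

/-- Feasibility for the dual SDP of the unknown-scale problem. -/
def IsDualFeasibleUnknown (θ : Measurements T) (Λ : Mat3) : Prop :=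
  Λ.IsSymm ∧ (dualMatrixUnknown θ Λ).PosSemidef

/-- Optimality for the dual SDP of the unknown-scale problem: maximize `tr Λ`. -/
def IsDualOptimalUnknown (θ : Measurements T) (Λ : Mat3) : Prop :=
  IsDualFeasibleUnknown θ Λ ∧ ∀ Λ', IsDualFeasibleUnknown θ Λ' → Λ'.trace ≤ Λ.trace

/-! ### Strong duality and recovery of the optimum -/

/-- Zero duality gap, known scale: both optimal values are attained, and they agree. -/
def StrongDualityKnown (θ : Measurements T) : Prop :=
  ∃ (R : Mat3) (τ : Vec3) (γ : ℝ) (Λ : Mat3),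
    IsOptimalKnown θ R τ ∧ IsDualOptimalKnown θ γ Λ ∧ γ = cost θ R τ 1

/-- Recovery, known scale: for every dual optimal solution the dual matrix has a nonzero null
vector, and every such vector, divided by its entry `y` (which is nonzero), is a global minimizer. -/
def RecoveryKnown (θ : Measurements T) : Prop :=
  ∀ (γ : ℝ) (Λ : Mat3), IsDualOptimalKnown θ γ Λ →
    (∃ x : StateIdx → ℝ, x ≠ 0 ∧ dualMatrixKnown θ γ Λ *ᵥ x = 0) ∧
    ∀ x : StateIdx → ℝ, x ≠ 0 → dualMatrixKnown θ γ Λ *ᵥ x = 0 →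
      stateScalar x ≠ 0 ∧
        IsOptimalKnown θ ((stateScalar x)⁻¹ • stateMat x) ((stateScalar x)⁻¹ • stateTr x)

/-- Zero duality gap, unknown scale: both optimal values are attained, and they agree. -/
def StrongDualityUnknown (θ : Measurements T) : Prop :=
  ∃ (R : Mat3) (τ : Vec3) (α : ℝ) (Λ : Mat3),
    IsOptimalUnknown θ R τ α ∧ IsDualOptimalUnknown θ Λ ∧ Λ.trace = cost θ R τ α

/-- Recovery, unknown scale: for every dual optimal solution the null space of the dual matrix is a
line, and every nonzero vector of it, divided by the positive number that makes its matrix block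
orthogonal, is a global minimizer. -/
def RecoveryUnknown (θ : Measurements T) : Prop :=
  ∀ Λ : Mat3, IsDualOptimalUnknown θ Λ →
    Module.finrank ℝ (LinearMap.ker (dualMatrixUnknown θ Λ).mulVecLin) = 1 ∧
    ∀ x : StateIdx → ℝ, x ≠ 0 → dualMatrixUnknown θ Λ *ᵥ x = 0 →
      ∃ c : ℝ, 0 < c ∧
        IsOptimalUnknown θ (c⁻¹ • stateMat x) (c⁻¹ • stateTr x) (c⁻¹ * stateScalar x)

/-! ### Hypotheses on the noise-free measurements -/

/-- `θ` is noise-free with ground truth `(R, τ)`: the measured motions are rigid motions, `(R, τ)`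
is a rigid transformation `Θ`, and `T_{b_t} Θ = Θ T_{a_t}` for every `t`. -/
structure IsNoiseFree (θ : Measurements T) (R : Mat3) (τ : Vec3) : Prop where
  rotA_mem : ∀ t, rotA θ t ∈ Matrix.specialOrthogonalGroup (Fin 3) ℝ
  rotB_mem : ∀ t, rotB θ t ∈ Matrix.specialOrthogonalGroup (Fin 3) ℝ
  rot_mem : R ∈ Matrix.specialOrthogonalGroup (Fin 3) ℝ
  rot_eq : ∀ t, rotB θ t * R = R * rotA θ t
  tr_eq : ∀ t, rotB θ t *ᵥ τ + trB θ t = R *ᵥ trA θ t + τ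

/-- The vectors fixed by `R`: the axis of `R` if `R ≠ I` is a rotation. -/
def axis (R : Mat3) : Submodule ℝ Vec3 := LinearMap.ker (R - 1).mulVecLin

/-- `R ≠ I` and `R² = I`; for a rotation, the rotation angle is `π`. -/
def IsHalfTurn (R : Mat3) : Prop := R ≠ 1 ∧ R * R = 1

/-- Every vector on the axis of `R` is orthogonal to every vector on the axis of `S`. -/
def PerpendicularAxes (R S : Mat3) : Prop := ∀ u ∈ axis R, ∀ v ∈ axis S, u ⬝ᵥ v = 0

/-- The span condition: `[R t_{a_i}; R t_{a_j}]` is not in the column span of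
`[I - R_{b_i}; I - R_{b_j}]`. -/
def SpanCondition (θ : Measurements T) (R : Mat3) (i j : Fin T) : Prop :=
  Sum.elim (R *ᵥ trA θ i) (R *ᵥ trA θ j) ∉
    Submodule.span ℝ (Set.range (Matrix.fromRows (1 - rotB θ i) (1 - rotB θ j)).col)

end HandEye

/-!
The hand-eye calibration cost is a quadratic form `q(x) = xᵀ Q x` in the state `x = (τ, s, vec R)`,
and for noise-free measurements it vanishes exactly on the line through the ground truth
`b = (τ, 1, R)` (`eq_smul_of_cost_eq_zero`). The reason is that a matrix commuting with both
rotations `R_{b_i}`, `R_{b_j}` is scalar (`exists_eq_smul_one_of_commute`): its antisymmetric part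
is the cross product with a common axis vector, and its symmetric part, if not scalar, has a simple
eigenline that both rotations fix or reverse. The span condition then determines the scale, and the
distinct axes determine the translation.

Two consequences hold for all measurements near the noise-free ones (`IsRegular`,
`eventually_isRegular`): the primal problems are coercive, and `Q + diag(0, c, -I ⊗ Λ)` is positive
definite on the hyperplane orthogonal to `b` whenever `c` and `Λ` are small.

A minimizer `x` of either primal problem therefore exists (`exists_minimizer`). Stationarity of the
cost along rotations of its matrix block `S` says that `Λ = G Sᵀ` is symmetric, where `G` is the
matrix block of `Q x` (`isSymm_multiplier`), and with this multiplier the dual matrix annihilates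
`x`. Since `Q` is positive semidefinite, the entries of `Q x` are bounded by a multiple of
`√(q x) ≤ √(q b)`, which is small near the noise-free measurements; so `Λ` is small, no matter where
the minimizer lies. A symmetric matrix with null vector `x` that is positive definite on a
hyperplane is positive semidefinite with kernel the line through `x` (`posSemidef_of_pos_add_sq`).
Hence `Λ` is dual feasible and its value is the primal one. By complementary slackness every dual
optimum annihilates `x`, and the orthogonality of `S` makes `Λ` the only multiplier that does
(`dualMatrix_mulVec_eq_zero_iff`), so every dual optimum has the kernel just described.
-/

namespace HandEye

variable {T : ℕ}

open Filter Topology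

/-! ### Rotations of three-space and their axes -/

lemma mem_axis {B : Mat3} {u : Vec3} : u ∈ axis B ↔ B *ᵥ u = u := by
  simp [axis, sub_eq_zero]

lemma transpose_mul_self_of_rotation {B : Mat3}
    (hB : B ∈ Matrix.specialOrthogonalGroup (Fin 3) ℝ) : Bᵀ * B = 1 :=
  (Matrix.mem_orthogonalGroup_iff' _ _).1 (Matrix.mem_specialOrthogonalGroup_iff.1 hB).1

lemma mul_transpose_self_of_rotation {B : Mat3}
    (hB : B ∈ Matrix.specialOrthogonalGroup (Fin 3) ℝ) : B * Bᵀ = 1 :=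
  (Matrix.mem_orthogonalGroup_iff _ _).1 (Matrix.mem_specialOrthogonalGroup_iff.1 hB).1

lemma dotProduct_mulVec_rotation {B : Mat3}
    (hB : B ∈ Matrix.specialOrthogonalGroup (Fin 3) ℝ) (u v : Vec3) :
    (B *ᵥ u) ⬝ᵥ (B *ᵥ v) = u ⬝ᵥ v := by
  rw [Matrix.dotProduct_mulVec, Matrix.vecMul_mulVec, transpose_mul_self_of_rotation hB,
    Matrix.vecMul_one]

/-- Rotations preserve the cross product, because a rotation equals its own cofactor matrix. -/
lemma mulVec_cross_rotation {B : Mat3} (hB : B ∈ Matrix.specialOrthogonalGroup (Fin 3) ℝ)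
    (u v : Vec3) : B *ᵥ (crossProduct u v) = crossProduct (B *ᵥ u) (B *ᵥ v) := by
  have hadj : B.adjugate = Bᵀ := by
    have h1 : B.adjugate * B = 1 := by
      rw [Matrix.adjugate_mul, (Matrix.mem_specialOrthogonalGroup_iff.1 hB).2, one_smul]
    calc B.adjugate = B.adjugate * (B * Bᵀ) := by
          rw [mul_transpose_self_of_rotation hB, mul_one]
      _ = Bᵀ := by rw [← mul_assoc, h1, one_mul]
  rw [Matrix.adjugate_fin_three] at hadj
  have h := fun i j => congrFun (congrFun hadj i) j
  have h00 := h 0 0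
  have h01 := h 0 1
  have h02 := h 0 2
  have h10 := h 1 0
  have h11 := h 1 1
  have h12 := h 1 2
  have h20 := h 2 0
  have h21 := h 2 1
  have h22 := h 2 2
  simp only [Matrix.of_apply, Matrix.cons_val', Matrix.cons_val_zero, Matrix.cons_val_one,
    Matrix.cons_val, Matrix.transpose_apply] at h00 h01 h02 h10 h11 h12 h20 h21 h22
  ext i
  fin_cases i <;>
    simp only [cross_apply, Matrix.mulVec, dotProduct, Fin.sum_univ_three, Fin.zero_eta, Fin.mk_one,
      Fin.reduceFinMk, Matrix.cons_val_zero, Matrix.cons_val_one, Matrix.cons_val]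
  · linear_combination -(u 1 * v 2 - u 2 * v 1) * h00 - (u 2 * v 0 - u 0 * v 2) * h10
      - (u 0 * v 1 - u 1 * v 0) * h20
  · linear_combination -(u 1 * v 2 - u 2 * v 1) * h01 - (u 2 * v 0 - u 0 * v 2) * h11
      - (u 0 * v 1 - u 1 * v 0) * h21
  · linear_combination -(u 1 * v 2 - u 2 * v 1) * h02 - (u 2 * v 0 - u 0 * v 2) * h12
      - (u 0 * v 1 - u 1 * v 0) * h22

/-- If a rotation fixes two independent vectors, it fixes their cross product as well, hence a
basis. So the axis of a rotation other than the identity is a line. -/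
lemma axis_eq_span {B : Mat3} (hB : B ∈ Matrix.specialOrthogonalGroup (Fin 3) ℝ) (hB1 : B ≠ 1)
    {u : Vec3} (hu : u ∈ axis B) (hu0 : u ≠ 0) : axis B = Submodule.span ℝ {u} := by
  refine le_antisymm (fun v hv => ?_) ((Submodule.span_singleton_le_iff_mem _ _).2 hu)
  by_contra hvu
  refine hB1 ?_
  have hli : LinearIndependent ℝ ![u, v] := by
    rw [LinearIndependent.pair_iff' hu0]
    intro a ha
    exact hvu (Submodule.mem_span_singleton.2 ⟨a, ha⟩)
  have hn : crossProduct u v ≠ 0 := crossProduct_ne_zero_iff_linearIndependent.2 hli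
  rw [mem_axis] at hu hv
  have hfix : B *ᵥ (crossProduct u v) = crossProduct u v := by
    rw [mulVec_cross_rotation hB, hu, hv]
  set P : Mat3 := (Matrix.of ![crossProduct u v, u, v])ᵀ with hP
  have hdet : P.det ≠ 0 := by
    rw [hP, Matrix.det_transpose]
    have := triple_product_eq_det (crossProduct u v) u v
    change Matrix.det ![crossProduct u v, u, v] ≠ 0
    rw [← this]
    simpa using hn
  have hBP : B * P = P := by
    have hcol : ∀ k, B *ᵥ P.col k = P.col k := by
      intro k
      fin_cases k
      · exact hfix
      · exact hu
      · exact hv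
    ext r k
    exact congrFun (hcol k) r
  have hunit : IsUnit P := (Matrix.isUnit_iff_isUnit_det P).2 hdet.isUnit
  exact hunit.mul_right_cancel (by rw [hBP, one_mul])

lemma eq_zero_of_mem_axes {B C : Mat3} (hB : B ∈ Matrix.specialOrthogonalGroup (Fin 3) ℝ)
    (hC : C ∈ Matrix.specialOrthogonalGroup (Fin 3) ℝ) (hB1 : B ≠ 1) (hC1 : C ≠ 1)
    (hne : axis B ≠ axis C) {u : Vec3} (hu : u ∈ axis B) (hv : u ∈ axis C) : u = 0 := by
  by_contra hu0
  exact hne ((axis_eq_span hB hB1 hu hu0).trans (axis_eq_span hC hC1 hv hu0).symm)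

/-- Every rotation of three-space has a nonzero fixed vector. -/
lemma exists_mem_axis {B : Mat3} (hB : B ∈ Matrix.specialOrthogonalGroup (Fin 3) ℝ) :
    ∃ w ∈ axis B, w ≠ 0 := by
  have hdet : (B - 1).det = 0 := by
    -- `B - 1 = -B (B - 1)ᵀ`, and `-B` has determinant `-1` in odd dimension
    have h1 : B - 1 = B * (-(B - 1)ᵀ) := by
      rw [Matrix.transpose_sub, Matrix.transpose_one, neg_sub, mul_sub, mul_one,
        mul_transpose_self_of_rotation hB]
    have h2 : (B - 1).det = -(B - 1).det := by
      conv_lhs => rw [h1]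
      rw [Matrix.det_mul, (Matrix.mem_specialOrthogonalGroup_iff.1 hB).2, Matrix.det_neg,
        Matrix.det_transpose]
      norm_num
    linarith
  obtain ⟨w, hw0, hw⟩ := Matrix.exists_mulVec_eq_zero_iff.2 hdet
  exact ⟨w, by simpa only [axis, LinearMap.mem_ker, Matrix.mulVecLin_apply] using hw, hw0⟩

lemma dotProduct_eq_zero_of_mulVec_eq_neg {B : Mat3}
    (hB : B ∈ Matrix.specialOrthogonalGroup (Fin 3) ℝ) {e u : Vec3} (he : B *ᵥ e = -e)
    (hu : u ∈ axis B) : u ⬝ᵥ e = 0 := by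
  have h := dotProduct_mulVec_rotation hB u e
  rw [he, mem_axis.1 hu, dotProduct_neg] at h
  linarith

/-- A rotation with eigenvalue `-1` is a half turn: with `e` the eigenvector and `w` on the axis,
the vectors `w`, `e`, `w × e` form a basis on which its square is the identity. -/
lemma isHalfTurn_of_mulVec_eq_neg {B : Mat3}
    (hB : B ∈ Matrix.specialOrthogonalGroup (Fin 3) ℝ) {e : Vec3} (he0 : e ≠ 0)
    (he : B *ᵥ e = -e) : IsHalfTurn B := by
  refine ⟨?_, ?_⟩
  · rintro rfl
    rw [Matrix.one_mulVec] at he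
    exact he0 (self_eq_neg.1 he)
  obtain ⟨w, hw, hw0⟩ := exists_mem_axis hB
  have hBB : B * B ∈ Matrix.specialOrthogonalGroup (Fin 3) ℝ := mul_mem hB hB
  by_contra hne
  have hw2 : w ∈ axis (B * B) := by
    rw [mem_axis] at hw ⊢
    rw [← Matrix.mulVec_mulVec, hw, hw]
  have he2 : e ∈ axis (B * B) := by
    rw [mem_axis, ← Matrix.mulVec_mulVec, he, Matrix.mulVec_neg, he, neg_neg]
  rw [axis_eq_span hBB hne hw2 hw0, Submodule.mem_span_singleton] at he2
  obtain ⟨a, ha⟩ := he2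
  have h0 := dotProduct_eq_zero_of_mulVec_eq_neg hB he hw
  rw [← ha, dotProduct_smul, smul_eq_mul, mul_eq_zero] at h0
  rcases h0 with h0 | h0
  · rw [h0, zero_smul] at ha
    exact he0 ha.symm
  · exact hw0 (dotProduct_self_eq_zero.1 h0)

/-! ### The commutant of two rotations -/

/-- An antisymmetric matrix is the cross product with a vector; it commutes with a rotation only if
the vector lies on the axis. -/
lemma eq_zero_of_antisymm_of_commute {B C A : Mat3}
    (hB : B ∈ Matrix.specialOrthogonalGroup (Fin 3) ℝ)
    (hC : C ∈ Matrix.specialOrthogonalGroup (Fin 3) ℝ) (hB1 : B ≠ 1) (hC1 : C ≠ 1)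
    (hne : axis B ≠ axis C) (hA : Aᵀ = -A) (hAB : Commute A B) (hAC : Commute A C) : A = 0 := by
  set w : Vec3 := ![A 2 1, A 0 2, A 1 0] with hw
  have hAt : ∀ r k, A k r = -A r k := fun r k => congrFun (congrFun hA r) k
  have hcross : ∀ v, A *ᵥ v = crossProduct w v := by
    intro v
    have h00 := hAt 0 0
    have h11 := hAt 1 1
    have h22 := hAt 2 2
    have e00 : A 0 0 = 0 := by linarith
    have e11 : A 1 1 = 0 := by linarith
    have e22 : A 2 2 = 0 := by linarith
    ext k
    fin_cases k <;>
      simp [hw, cross_apply, Matrix.mulVec, dotProduct, Fin.sum_univ_three, e00, e11, e22,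
        hAt 2 1, hAt 0 2, hAt 1 0] <;> ring
  have key : ∀ D : Mat3, D ∈ Matrix.specialOrthogonalGroup (Fin 3) ℝ → Commute A D →
      w ∈ axis D := by
    intro D hD hAD
    rw [mem_axis]
    -- the difference `D w - w` has zero cross product with every `D v`, hence with every vector
    have h0 : ∀ v, crossProduct (D *ᵥ w - w) v = 0 := by
      intro v
      have h1 : A *ᵥ (D *ᵥ (Dᵀ *ᵥ v)) = D *ᵥ (A *ᵥ (Dᵀ *ᵥ v)) := by
        rw [Matrix.mulVec_mulVec, hAD.eq, ← Matrix.mulVec_mulVec]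
      rw [hcross (Dᵀ *ᵥ v), mulVec_cross_rotation hD, hcross] at h1
      rw [Matrix.mulVec_mulVec, mul_transpose_self_of_rotation hD, Matrix.one_mulVec] at h1
      rw [map_sub, LinearMap.sub_apply, h1, sub_self]
    refine sub_eq_zero.1 ?_
    set d := D *ᵥ w - w
    have h1 := h0 ![1, 0, 0]
    have h2 := h0 ![0, 1, 0]
    rw [cross_apply] at h1 h2
    have a1 := congrFun h1 1
    have a2 := congrFun h1 2
    have a3 := congrFun h2 0
    simp at a1 a2 a3
    ext k
    fin_cases k
    · simpa using congrFun h2 2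
    · simpa using a2
    · simpa using a1
  have hw0 : w = 0 := eq_zero_of_mem_axes hB hC hB1 hC1 hne (key B hB hAB) (key C hC hAC)
  refine Matrix.ext_of_mulVec_single fun k => ?_
  rw [hcross, hw0, map_zero, LinearMap.zero_apply, Matrix.zero_mulVec]

/-- A symmetric `3 × 3` matrix that is not scalar has a simple eigenvalue. -/
lemma exists_simple_eigenvector {M : Mat3} (hM : M.IsSymm) (hns : ∀ a : ℝ, M ≠ a • 1) :
    ∃ (l : ℝ) (e : Vec3), e ≠ 0 ∧ M *ᵥ e = l • e ∧
      ∀ v, M *ᵥ v = l • v → ∃ a : ℝ, v = a • e := by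
  have hH : M.IsHermitian := by
    rw [Matrix.IsHermitian, Matrix.conjTranspose_eq_transpose_of_trivial]
    exact hM
  obtain ⟨U, d, hU, hU', hMd⟩ : ∃ (U : Mat3) (d : Fin 3 → ℝ), U * Uᵀ = 1 ∧ Uᵀ * U = 1 ∧
      M = U * Matrix.diagonal d * Uᵀ := by
    refine ⟨hH.eigenvectorUnitary, hH.eigenvalues, ?_, ?_, ?_⟩
    · exact (Matrix.mem_orthogonalGroup_iff _ _).1 hH.eigenvectorUnitary.2
    · exact (Matrix.mem_orthogonalGroup_iff' _ _).1 hH.eigenvectorUnitary.2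
    · have := hH.spectral_theorem
      rw [Unitary.conjStarAlgAut_apply] at this
      exact this
  obtain ⟨k, hk⟩ : ∃ k, ∀ l, l ≠ k → d l ≠ d k := by
    by_contra! hcon
    have hall : ∀ l, d l = d 0 := by
      obtain ⟨l0, h0, e0⟩ := hcon 0
      obtain ⟨l1, h1, e1⟩ := hcon 1
      obtain ⟨l2, h2, e2⟩ := hcon 2
      intro l
      fin_cases l0 <;> fin_cases l1 <;> fin_cases l2 <;> fin_cases l <;> simp_all
    refine hns (d 0) ?_
    have : Matrix.diagonal d = d 0 • (1 : Mat3) := by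
      rw [Matrix.smul_one_eq_diagonal]
      exact congrArg _ (funext hall)
    rw [hMd, this, Matrix.mul_smul, mul_one, Matrix.smul_mul, hU]
  refine ⟨d k, U *ᵥ Pi.single k 1, ?_, ?_, ?_⟩
  · intro h
    have := congrArg (Uᵀ *ᵥ ·) h
    simp only [Matrix.mulVec_mulVec, hU', Matrix.one_mulVec, Matrix.mulVec_zero] at this
    simpa using congrFun this k
  · rw [hMd, Matrix.mulVec_mulVec, mul_assoc, hU', mul_one, ← Matrix.mulVec_mulVec,
      ← Matrix.mulVec_smul]
    congr 1
    ext l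
    rw [Matrix.mulVec_diagonal]
    by_cases hl : l = k
    · simp [hl]
    · simp [hl]
  · intro v hv
    refine ⟨(Uᵀ *ᵥ v) k, ?_⟩
    have h1 : Matrix.diagonal d *ᵥ (Uᵀ *ᵥ v) = d k • (Uᵀ *ᵥ v) := by
      rw [← Matrix.mulVec_smul, ← hv, hMd, Matrix.mulVec_mulVec, Matrix.mulVec_mulVec,
        ← mul_assoc, ← mul_assoc, hU', one_mul]
    have h2 : Uᵀ *ᵥ v = (Uᵀ *ᵥ v) k • Pi.single k 1 := by
      ext l
      by_cases hl : l = k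
      · simp [hl]
      · have := congrFun h1 l
        rw [Matrix.mulVec_diagonal, Pi.smul_apply, smul_eq_mul] at this
        have h3 : (d l - d k) * (Uᵀ *ᵥ v) l = 0 := by linarith
        have h4 := (mul_eq_zero.1 h3).resolve_left (sub_ne_zero.2 (hk l hl))
        rw [h4]
        simp [hl]
    rw [← Matrix.mulVec_smul, ← h2, Matrix.mulVec_mulVec, hU, Matrix.one_mulVec]

/-- A rotation that maps a nonzero vector to a multiple of itself fixes it or reverses it. -/
lemma mulVec_eq_or_eq_neg_of_rotation {B : Mat3}
    (hB : B ∈ Matrix.specialOrthogonalGroup (Fin 3) ℝ) {e : Vec3} (he0 : e ≠ 0) {a : ℝ}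
    (ha : B *ᵥ e = a • e) : B *ᵥ e = e ∨ B *ᵥ e = -e := by
  have h := dotProduct_mulVec_rotation hB e e
  rw [ha, smul_dotProduct, dotProduct_smul, smul_eq_mul, smul_eq_mul, ← mul_assoc] at h
  have h1 : a * a = 1 := mul_right_cancel₀ (mt dotProduct_self_eq_zero.1 he0) (by rw [h, one_mul])
  rcases mul_self_eq_one_iff.1 h1 with rfl | rfl
  · exact Or.inl (by rw [ha, one_smul])
  · exact Or.inr (by rw [ha, neg_one_smul])

/-- The simple eigenline of a symmetric matrix commuting with two rotations is invariant under both.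
Each rotation fixes it or reverses it, and every combination is excluded by the hypotheses. -/
lemma exists_eq_smul_one_of_symm_of_commute {B C M : Mat3}
    (hB : B ∈ Matrix.specialOrthogonalGroup (Fin 3) ℝ)
    (hC : C ∈ Matrix.specialOrthogonalGroup (Fin 3) ℝ) (hB1 : B ≠ 1) (hC1 : C ≠ 1)
    (hne : axis B ≠ axis C) (hhalf : ¬ (IsHalfTurn B ∧ IsHalfTurn C))
    (hperp : IsHalfTurn B ∨ IsHalfTurn C → ¬ PerpendicularAxes B C)
    (hM : M.IsSymm) (hMB : Commute M B) (hMC : Commute M C) : ∃ a : ℝ, M = a • 1 := by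
  by_contra! hns
  obtain ⟨l, e, he0, he, hsimple⟩ := exists_simple_eigenvector hM hns
  have hinv : ∀ D : Mat3, D ∈ Matrix.specialOrthogonalGroup (Fin 3) ℝ → Commute M D →
      D *ᵥ e = e ∨ D *ᵥ e = -e := by
    intro D hD hMD
    have h1 : M *ᵥ (D *ᵥ e) = l • (D *ᵥ e) := by
      rw [Matrix.mulVec_mulVec, hMD.eq, ← Matrix.mulVec_mulVec, he, Matrix.mulVec_smul]
    obtain ⟨a, ha⟩ := hsimple _ h1
    exact mulVec_eq_or_eq_neg_of_rotation hD he0 ha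
  rcases hinv B hB hMB with hBe | hBe <;> rcases hinv C hC hMC with hCe | hCe
  · exact he0 (eq_zero_of_mem_axes hB hC hB1 hC1 hne (mem_axis.2 hBe) (mem_axis.2 hCe))
  · refine hperp (Or.inr (isHalfTurn_of_mulVec_eq_neg hC he0 hCe)) fun u hu v hv => ?_
    rw [axis_eq_span hB hB1 (mem_axis.2 hBe) he0, Submodule.mem_span_singleton] at hu
    obtain ⟨a, rfl⟩ := hu
    rw [smul_dotProduct, dotProduct_comm, dotProduct_eq_zero_of_mulVec_eq_neg hC hCe hv, smul_zero]
  · refine hperp (Or.inl (isHalfTurn_of_mulVec_eq_neg hB he0 hBe)) fun u hu v hv => ?_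
    rw [axis_eq_span hC hC1 (mem_axis.2 hCe) he0, Submodule.mem_span_singleton] at hv
    obtain ⟨a, rfl⟩ := hv
    rw [dotProduct_smul, dotProduct_eq_zero_of_mulVec_eq_neg hB hBe hu, smul_zero]
  · exact hhalf ⟨isHalfTurn_of_mulVec_eq_neg hB he0 hBe, isHalfTurn_of_mulVec_eq_neg hC he0 hCe⟩

lemma commute_transpose_of_rotation {B M : Mat3}
    (hB : B ∈ Matrix.specialOrthogonalGroup (Fin 3) ℝ) (h : Commute M B) : Commute Mᵀ B := by
  have h1 : Bᵀ * Mᵀ = Mᵀ * Bᵀ := by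
    rw [← Matrix.transpose_mul, h.eq, Matrix.transpose_mul]
  calc Mᵀ * B = (B * Bᵀ) * (Mᵀ * B) := by rw [mul_transpose_self_of_rotation hB, one_mul]
    _ = B * (Bᵀ * Mᵀ) * B := by simp only [mul_assoc]
    _ = B * Mᵀ * (Bᵀ * B) := by rw [h1]; simp only [mul_assoc]
    _ = B * Mᵀ := by rw [transpose_mul_self_of_rotation hB, mul_one]

/-- Only scalar matrices commute with both rotations. The commutant of an orthogonal matrix is
closed under transposition, so the symmetric and the antisymmetric part can be treated apart. -/
lemma exists_eq_smul_one_of_commute {B C M : Mat3}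
    (hB : B ∈ Matrix.specialOrthogonalGroup (Fin 3) ℝ)
    (hC : C ∈ Matrix.specialOrthogonalGroup (Fin 3) ℝ) (hB1 : B ≠ 1) (hC1 : C ≠ 1)
    (hne : axis B ≠ axis C) (hhalf : ¬ (IsHalfTurn B ∧ IsHalfTurn C))
    (hperp : IsHalfTurn B ∨ IsHalfTurn C → ¬ PerpendicularAxes B C)
    (hMB : Commute M B) (hMC : Commute M C) : ∃ a : ℝ, M = a • 1 := by
  have hMBt := commute_transpose_of_rotation hB hMB
  have hMCt := commute_transpose_of_rotation hC hMC
  have hA : M - Mᵀ = 0 := eq_zero_of_antisymm_of_commute hB hC hB1 hC1 hne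
    (by simp) (hMB.sub_left hMBt) (hMC.sub_left hMCt)
  exact exists_eq_smul_one_of_symm_of_commute hB hC hB1 hC1 hne hhalf hperp
    (sub_eq_zero.1 hA).symm hMB hMC

/-! ### States and the quadratic forms on them -/

/-- The state `(τ, s, vec S)`. -/
def mkState (τ : Vec3) (s : ℝ) (S : Mat3) : StateIdx → ℝ :=
  Sum.elim τ (Sum.elim (fun _ => s) S.vec)

@[simp] lemma mkState_state (x : StateIdx → ℝ) :
    mkState (stateTr x) (stateScalar x) (stateMat x) = x := by
  funext p
  rcases p with i | u | p <;> rfl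

@[simp] lemma stateTr_smul (c : ℝ) (x : StateIdx → ℝ) : stateTr (c • x) = c • stateTr x := rfl

@[simp] lemma stateScalar_smul (c : ℝ) (x : StateIdx → ℝ) :
    stateScalar (c • x) = c * stateScalar x := rfl

@[simp] lemma stateMat_smul (c : ℝ) (x : StateIdx → ℝ) : stateMat (c • x) = c • stateMat x := rfl

lemma smul_mkState (c : ℝ) (τ : Vec3) (s : ℝ) (S : Mat3) :
    c • mkState τ s S = mkState (c • τ) (c * s) (c • S) := by
  rw [← mkState_state (c • mkState τ s S)]
  rfl

lemma mkState_add (τ τ' : Vec3) (s s' : ℝ) (S S' : Mat3) :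
    mkState τ s S + mkState τ' s' S' = mkState (τ + τ') (s + s') (S + S') := by
  rw [← mkState_state (mkState τ s S + mkState τ' s' S')]
  rfl

@[simp] lemma mkState_zero : mkState 0 0 0 = 0 := by
  rw [← mkState_state 0]
  rfl

lemma dotProduct_mkState (x : StateIdx → ℝ) (τ : Vec3) (s : ℝ) (S : Mat3) :
    x ⬝ᵥ mkState τ s S =
      stateTr x ⬝ᵥ τ + stateScalar x * s + ((stateMat x)ᵀ * S).trace := by
  have hx : x = Sum.elim (stateTr x) (Sum.elim (fun _ => stateScalar x) (stateMat x).vec) :=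
    (mkState_state x).symm
  conv_lhs => rw [hx]
  rw [mkState, sumElim_dotProduct_sumElim, sumElim_dotProduct_sumElim,
    Matrix.vec_dotProduct_vec]
  simp [dotProduct, add_assoc]

lemma rotResidual_mulVec (θ : Measurements T) (t : Fin T) (x : StateIdx → ℝ) :
    rotResidual θ t *ᵥ x = (stateMat x * rotA θ t - rotB θ t * stateMat x).vec := by
  have hx : x = Sum.elim (stateTr x) (Sum.elim (fun _ => stateScalar x) (stateMat x).vec) :=
    (mkState_state x).symm
  conv_lhs => rw [hx]
  rw [rotResidual, Matrix.fromCols_mulVec_sumElim, Matrix.fromCols_mulVec_sumElim,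
    Matrix.zero_mulVec, Matrix.zero_mulVec, zero_add, zero_add, Matrix.sub_mulVec,
    Matrix.kronecker_mulVec_vec, Matrix.kronecker_mulVec_vec, Matrix.vec_sub]
  simp

lemma trResidual_mulVec (θ : Measurements T) (t : Fin T) (x : StateIdx → ℝ) :
    trResidual θ t *ᵥ x = stateMat x *ᵥ trA θ t + stateTr x - rotB θ t *ᵥ stateTr x -
      stateScalar x • trB θ t := by
  have hx : x = Sum.elim (stateTr x) (Sum.elim (fun _ => stateScalar x) (stateMat x).vec) :=
    (mkState_state x).symm
  conv_lhs => rw [hx]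
  rw [trResidual, Matrix.fromCols_mulVec_sumElim, Matrix.fromCols_mulVec_sumElim,
    Matrix.sub_mulVec, Matrix.one_mulVec]
  have h1 : (Matrix.of fun i (p : Fin 3 × Fin 3) => trA θ t p.1 * (1 : Mat3) i p.2) *ᵥ
      (stateMat x).vec = stateMat x *ᵥ trA θ t := by
    ext i
    simp [Matrix.mulVec, dotProduct, Fintype.sum_prod_type, Matrix.one_apply, mul_comm]
  have h2 : (Matrix.of fun i (_ : Unit) => -trB θ t i) *ᵥ (fun _ => stateScalar x) =
      -(stateScalar x • trB θ t) := by
    ext i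
    simp [Matrix.mulVec, dotProduct, mul_comm]
  rw [h1, h2]
  abel

lemma dotProduct_costMatrix_mulVec (θ : Measurements T) (x : StateIdx → ℝ) :
    x ⬝ᵥ costMatrix θ *ᵥ x = cost θ (stateMat x) (stateTr x) (stateScalar x) := by
  have h : ∀ t, x ⬝ᵥ ((rotResidual θ t)ᵀ * rotResidual θ t +
      (trResidual θ t)ᵀ * trResidual θ t) *ᵥ x =
      (rotResidual θ t *ᵥ x) ⬝ᵥ (rotResidual θ t *ᵥ x) +
      (trResidual θ t *ᵥ x) ⬝ᵥ (trResidual θ t *ᵥ x) := by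
    intro t
    rw [Matrix.add_mulVec, dotProduct_add, ← Matrix.mulVec_mulVec, ← Matrix.mulVec_mulVec,
      Matrix.dotProduct_mulVec x, Matrix.vecMul_transpose, Matrix.dotProduct_mulVec x,
      Matrix.vecMul_transpose]
  rw [costMatrix, Matrix.sum_mulVec, dotProduct_sum, Finset.sum_congr rfl fun t _ => h t,
    Finset.sum_add_distrib, add_comm, cost, trCost, rotCost]
  congr 1
  · refine Finset.sum_congr rfl fun t _ => ?_
    rw [trResidual_mulVec]
    simp only [dotProduct, pow_two]
  · refine Finset.sum_congr rfl fun t _ => ?_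
    rw [rotResidual_mulVec]
    simp only [dotProduct, Fintype.sum_prod_type, Matrix.vec, pow_two]
    rw [Finset.sum_comm]

lemma isSymm_costMatrix (θ : Measurements T) : (costMatrix θ).IsSymm := by
  rw [Matrix.IsSymm, costMatrix, Matrix.transpose_sum]
  simp [Matrix.transpose_add, Matrix.transpose_mul]

lemma cost_nonneg (θ : Measurements T) (R : Mat3) (τ : Vec3) (α : ℝ) : 0 ≤ cost θ R τ α := by
  unfold cost trCost rotCost
  positivity

lemma posSemidef_costMatrix (θ : Measurements T) : (costMatrix θ).PosSemidef := by
  refine Matrix.PosSemidef.of_dotProduct_mulVec_nonneg ?_ fun x => ?_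
  · rw [Matrix.IsHermitian, Matrix.conjTranspose_eq_transpose_of_trivial]
    exact isSymm_costMatrix θ
  · rw [star_trivial, dotProduct_costMatrix_mulVec]
    exact cost_nonneg _ _ _ _

lemma multiplierMatrix_mulVec (c : ℝ) (Λ : Mat3) (x : StateIdx → ℝ) :
    multiplierMatrix c Λ *ᵥ x = mkState 0 (c * stateScalar x) (-(Λ * stateMat x)) := by
  have hx : x = Sum.elim (stateTr x) (Sum.elim (fun _ => stateScalar x) (stateMat x).vec) :=
    (mkState_state x).symm
  conv_lhs => rw [hx]
  rw [multiplierMatrix, Matrix.fromBlocks_mulVec, mkState]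
  simp only [Sum.elim_comp_inl, Sum.elim_comp_inr, Matrix.fromBlocks_mulVec, Matrix.zero_mulVec,
    zero_add, add_zero, Matrix.neg_mulVec, Matrix.kronecker_mulVec_vec, Matrix.smul_mulVec,
    Matrix.one_mulVec, Matrix.transpose_one, mul_one, Matrix.vec_neg]
  rfl

lemma dotProduct_multiplierMatrix_mulVec (c : ℝ) (Λ : Mat3) (x : StateIdx → ℝ) :
    x ⬝ᵥ multiplierMatrix c Λ *ᵥ x =
      c * stateScalar x ^ 2 - (Λ * (stateMat x * (stateMat x)ᵀ)).trace := by
  rw [multiplierMatrix_mulVec, dotProduct_mkState, dotProduct_zero, Matrix.mul_neg,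
    Matrix.trace_neg, Matrix.trace_mul_comm, mul_assoc]
  ring

lemma isSymm_multiplierMatrix {c : ℝ} {Λ : Mat3} (hΛ : Λ.IsSymm) :
    (multiplierMatrix c Λ).IsSymm := by
  rw [Matrix.IsSymm, multiplierMatrix, Matrix.fromBlocks_transpose, Matrix.fromBlocks_transpose,
    Matrix.transpose_neg, Matrix.transpose_smul, Matrix.transpose_one, Matrix.transpose_zero,
    ← Matrix.kroneckerMap_transpose, hΛ.eq]
  simp

/-! ### Noise-free measurements -/

/-- For noise-free measurements the cost vanishes only on the line through the ground truth. The
rotation residuals say that `S Rᵀ` commutes with every `R_{b_t}`, so it is a scalar `a`; the span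
condition then forces `a = s`, and the distinct axes force `σ = s τ`. -/
lemma eq_smul_of_cost_eq_zero {θ : Measurements T} {R : Mat3} {τ : Vec3} (hfree : IsNoiseFree θ R τ)
    {i j : Fin T} (hi : rotB θ i ≠ 1) (hj : rotB θ j ≠ 1)
    (haxes : axis (rotB θ i) ≠ axis (rotB θ j))
    (hhalf : ¬ (IsHalfTurn (rotB θ i) ∧ IsHalfTurn (rotB θ j)))
    (hperp : IsHalfTurn (rotB θ i) ∨ IsHalfTurn (rotB θ j) →
      ¬ PerpendicularAxes (rotB θ i) (rotB θ j))
    (hspan : SpanCondition θ R i j) {S : Mat3} {σ : Vec3} {s : ℝ} (h0 : cost θ S σ s = 0) :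
    σ = s • τ ∧ S = s • R := by
  have hRR : Rᵀ * R = 1 := transpose_mul_self_of_rotation hfree.rot_mem
  have hR' : R * Rᵀ = 1 := mul_transpose_self_of_rotation hfree.rot_mem
  have hrot0 : 0 ≤ rotCost θ S := by unfold rotCost; positivity
  have htr0 : 0 ≤ trCost θ S σ s := by unfold trCost; positivity
  rw [cost] at h0
  have hrot : rotCost θ S = 0 := by linarith
  have htr : trCost θ S σ s = 0 := by linarith
  have hrot_t : ∀ t, S * rotA θ t = rotB θ t * S := by
    intro t
    rw [rotCost, Finset.sum_eq_zero_iff_of_nonneg (fun _ _ => by positivity)] at hrot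
    ext k l
    have h1 := hrot t (Finset.mem_univ _)
    rw [Finset.sum_eq_zero_iff_of_nonneg (fun _ _ => by positivity)] at h1
    have h2 := h1 k (Finset.mem_univ _)
    rw [Finset.sum_eq_zero_iff_of_nonneg (fun _ _ => by positivity)] at h2
    exact sub_eq_zero.1 (pow_eq_zero_iff two_ne_zero |>.1 (h2 l (Finset.mem_univ _)))
  have htr_t : ∀ t, S *ᵥ trA θ t + σ - rotB θ t *ᵥ σ - s • trB θ t = 0 := by
    intro t
    rw [trCost, Finset.sum_eq_zero_iff_of_nonneg (fun _ _ => by positivity)] at htr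
    ext k
    have h1 := htr t (Finset.mem_univ _)
    rw [Finset.sum_eq_zero_iff_of_nonneg (fun _ _ => by positivity)] at h1
    exact pow_eq_zero_iff two_ne_zero |>.1 (h1 k (Finset.mem_univ _))
  have hcomm : ∀ t, Commute (S * Rᵀ) (rotB θ t) := by
    intro t
    have hB : rotB θ t = R * rotA θ t * Rᵀ := by
      rw [← hfree.rot_eq, mul_assoc, hR', mul_one]
    calc S * Rᵀ * rotB θ t = S * (Rᵀ * R) * rotA θ t * Rᵀ := by
          rw [hB]; simp only [mul_assoc]
      _ = rotB θ t * (S * Rᵀ) := by rw [hRR, mul_one, hrot_t, mul_assoc]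
  obtain ⟨a, ha⟩ := exists_eq_smul_one_of_commute (hfree.rotB_mem i) (hfree.rotB_mem j) hi hj haxes
    hhalf hperp (hcomm i) (hcomm j)
  have hS : S = a • R := by
    calc S = S * Rᵀ * R := by rw [mul_assoc, hRR, mul_one]
      _ = a • R := by rw [ha, Matrix.smul_mul, one_mul]
  have hres : ∀ t, (s - a) • (R *ᵥ trA θ t) = (1 - rotB θ t) *ᵥ (σ - s • τ) := by
    intro t
    have h1 := htr_t t
    rw [hS, eq_sub_of_add_eq' (hfree.tr_eq t), Matrix.smul_mulVec] at h1
    rw [Matrix.sub_mulVec, Matrix.one_mulVec, Matrix.mulVec_sub, Matrix.mulVec_smul]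
    rw [← sub_eq_zero, ← neg_eq_zero, ← h1]
    module
  have has : a = s := by
    by_contra hne
    have hne' : s - a ≠ 0 := sub_ne_zero.2 (Ne.symm hne)
    refine hspan ?_
    rw [← Matrix.range_mulVecLin]
    refine ⟨(s - a)⁻¹ • (σ - s • τ), ?_⟩
    rw [Matrix.mulVecLin_apply, Matrix.fromRows_mulVec, Matrix.mulVec_smul, Matrix.mulVec_smul,
      ← hres i, ← hres j, inv_smul_smul₀ hne', inv_smul_smul₀ hne']
  have hfix : ∀ t, σ - s • τ ∈ axis (rotB θ t) := by
    intro t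
    have h1 := hres t
    rw [has, sub_self, zero_smul, Matrix.sub_mulVec, Matrix.one_mulVec] at h1
    exact mem_axis.2 (sub_eq_zero.1 h1.symm).symm
  refine ⟨?_, by rw [hS, has]⟩
  exact sub_eq_zero.1 (eq_zero_of_mem_axes (hfree.rotB_mem i) (hfree.rotB_mem j) hi hj haxes
    (hfix i) (hfix j))

lemma cost_groundTruth {θ : Measurements T} {R : Mat3} {τ : Vec3} (hfree : IsNoiseFree θ R τ) :
    cost θ R τ 1 = 0 := by
  have h1 : ∀ t, R * rotA θ t - rotB θ t * R = 0 := fun t => sub_eq_zero.2 (hfree.rot_eq t).symm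
  have h2 : ∀ t, R *ᵥ trA θ t + τ - rotB θ t *ᵥ τ - (1 : ℝ) • trB θ t = 0 := by
    intro t
    rw [← hfree.tr_eq t]
    module
  simp only [cost, trCost, rotCost, h1, h2]
  simp

/-! ### Quadratic forms -/

section QuadraticForms

variable {n : Type*} [Fintype n] {A : Matrix n n ℝ}

lemma dotProduct_mulVec_comm_of_isSymm (hA : A.IsSymm) (u v : n → ℝ) :
    u ⬝ᵥ A *ᵥ v = v ⬝ᵥ A *ᵥ u := by
  rw [Matrix.dotProduct_mulVec, ← Matrix.mulVec_transpose, hA.eq, dotProduct_comm]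

lemma dotProduct_mulVec_add_smul (hA : A.IsSymm) (x u : n → ℝ) (t : ℝ) :
    (x + t • u) ⬝ᵥ A *ᵥ (x + t • u) =
      x ⬝ᵥ A *ᵥ x + 2 * t * (u ⬝ᵥ A *ᵥ x) + t * t * (u ⬝ᵥ A *ᵥ u) := by
  simp only [Matrix.mulVec_add, Matrix.mulVec_smul, add_dotProduct, dotProduct_add,
    smul_dotProduct, dotProduct_smul, smul_eq_mul]
  rw [dotProduct_mulVec_comm_of_isSymm hA x u]
  ring

/-- The Cauchy–Schwarz inequality of a positive semidefinite form. -/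
lemma sq_dotProduct_mulVec_le (hA : A.PosSemidef) (u x : n → ℝ) :
    (u ⬝ᵥ A *ᵥ x) ^ 2 ≤ (u ⬝ᵥ A *ᵥ u) * (x ⬝ᵥ A *ᵥ x) := by
  have hsymm : A.IsSymm := by
    have := hA.1
    rwa [Matrix.IsHermitian, Matrix.conjTranspose_eq_transpose_of_trivial] at this
  have h := discrim_le_zero (a := u ⬝ᵥ A *ᵥ u) (b := 2 * (u ⬝ᵥ A *ᵥ x)) (c := x ⬝ᵥ A *ᵥ x)
    fun t => by
      have h1 := hA.dotProduct_mulVec_nonneg (x + t • u)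
      rw [star_trivial, dotProduct_mulVec_add_smul hsymm] at h1
      linarith
  rw [discrim] at h
  linarith

/-- A quadratic form that becomes positive definite when the square of a linear form `b` is added,
and whose matrix annihilates `x ≠ 0`, is positive semidefinite with kernel the line through `x`: it
is positive definite on the hyperplane orthogonal to `b`, and `x` is transversal to it. -/
lemma posSemidef_of_pos_add_sq (hA : A.IsSymm) {b x : n → ℝ} (hx0 : x ≠ 0) (hx : A *ᵥ x = 0)
    (hpos : ∀ v, v ≠ 0 → 0 < v ⬝ᵥ A *ᵥ v + (b ⬝ᵥ v) ^ 2) :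
    A.PosSemidef ∧ ∀ v, A *ᵥ v = 0 → ∃ a : ℝ, v = a • x := by
  have hbx : b ⬝ᵥ x ≠ 0 := by
    intro h0
    have h1 := hpos x hx0
    rw [hx, h0, dotProduct_zero] at h1
    norm_num at h1
  have key : ∀ v, ∃ (a : ℝ) (w : n → ℝ), v = a • x + w ∧ v ⬝ᵥ A *ᵥ v = w ⬝ᵥ A *ᵥ w ∧
      (w ≠ 0 → 0 < w ⬝ᵥ A *ᵥ w) := by
    intro v
    set a := (b ⬝ᵥ v) / (b ⬝ᵥ x) with ha
    set w := v - a • x with hw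
    have hv : v = w + a • x := by rw [hw, sub_add_cancel]
    refine ⟨a, w, by rw [hv, add_comm], ?_, fun hw0 => ?_⟩
    · rw [hv, dotProduct_mulVec_add_smul hA, dotProduct_mulVec_comm_of_isSymm hA x w, hx,
        dotProduct_zero, dotProduct_zero]
      ring
    · have hbw : b ⬝ᵥ w = 0 := by
        rw [hw, dotProduct_sub, dotProduct_smul, smul_eq_mul, ha, div_mul_cancel₀ _ hbx, sub_self]
      have h1 := hpos w hw0
      rw [hbw] at h1
      linarith
  refine ⟨Matrix.PosSemidef.of_dotProduct_mulVec_nonneg ?_ fun v => ?_, fun v hv => ?_⟩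
  · rw [Matrix.IsHermitian, Matrix.conjTranspose_eq_transpose_of_trivial]
    exact hA
  · obtain ⟨a, w, -, h1, h2⟩ := key v
    rw [star_trivial, h1]
    by_cases hw : w = 0
    · simp [hw]
    · exact (h2 hw).le
  · obtain ⟨a, w, h0, h1, h2⟩ := key v
    rw [hv, dotProduct_zero] at h1
    have hw : w = 0 := by
      by_contra hw
      exact (h2 hw).ne h1
    exact ⟨a, by rw [h0, hw, add_zero]⟩

/-- If a curve through `φ 0` never goes below the value of the form there, then the form's gradient
at `φ 0` vanishes along the velocity of the curve. -/
lemma dotProduct_mulVec_eq_zero_of_forall_le (hA : A.IsSymm) {φ : ℝ → n → ℝ} {u : n → ℝ}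
    (hφ : ∀ p, HasDerivAt (fun t => φ t p) (u p) 0)
    (hmin : ∀ t, φ 0 ⬝ᵥ A *ᵥ φ 0 ≤ φ t ⬝ᵥ A *ᵥ φ t) : u ⬝ᵥ A *ᵥ φ 0 = 0 := by
  have hder : HasDerivAt (fun t => φ t ⬝ᵥ A *ᵥ φ t)
      (∑ p, (u p * (∑ q, A p q * φ 0 q) + φ 0 p * ∑ q, A p q * u q)) 0 :=
    HasDerivAt.fun_sum fun p _ => (hφ p).mul (HasDerivAt.fun_sum fun q _ => (hφ q).const_mul _)
  have h0 := IsLocalMin.hasDerivAt_eq_zero (Eventually.of_forall hmin) hder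
  rw [Finset.sum_add_distrib] at h0
  change u ⬝ᵥ A *ᵥ φ 0 + φ 0 ⬝ᵥ A *ᵥ u = 0 at h0
  rw [dotProduct_mulVec_comm_of_isSymm hA (φ 0) u] at h0
  linarith

/-- Positivity of a homogeneous function of degree two is an open condition on its parameter, since
it can be tested on the unit sphere. -/
lemma eventually_forall_pos {X : Type*} [TopologicalSpace X] {F : X → (n → ℝ) → ℝ}
    (hF : Continuous fun z : X × (n → ℝ) => F z.1 z.2)
    (hsmul : ∀ z (a : ℝ) v, F z (a • v) = a ^ 2 * F z v) {z₀ : X}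
    (hpos : ∀ v, v ≠ 0 → 0 < F z₀ v) : ∀ᶠ z in 𝓝 z₀, ∀ v, v ≠ 0 → 0 < F z v := by
  have h1 : ∀ᶠ z in 𝓝 z₀, ∀ v ∈ Metric.sphere (0 : n → ℝ) 1, 0 < F z v := by
    refine (isCompact_sphere 0 1).eventually_forall_of_forall_eventually fun v hv => ?_
    refine hF.continuousAt.eventually_const_lt (hpos v ?_)
    rintro rfl
    simp at hv
  filter_upwards [h1] with z hz v hv
  have hv' : ‖v‖ ≠ 0 := norm_ne_zero_iff.2 hv
  have h2 : v = ‖v‖ • (‖v‖⁻¹ • v) := by rw [smul_inv_smul₀ hv']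
  rw [h2, hsmul]
  have h3 := hz (‖v‖⁻¹ • v) (by simp [norm_smul, hv'])
  positivity

/-- A positive homogeneous function of degree two is coercive. -/
lemma exists_mul_sq_norm_le {F : (n → ℝ) → ℝ} (hF : Continuous F)
    (hsmul : ∀ (a : ℝ) v, F (a • v) = a ^ 2 * F v) (hpos : ∀ v, v ≠ 0 → 0 < F v) :
    ∃ μ : ℝ, 0 < μ ∧ ∀ v, μ * ‖v‖ ^ 2 ≤ F v := by
  rcases (Metric.sphere (0 : n → ℝ) 1).eq_empty_or_nonempty with hempty | hne
  · refine ⟨1, one_pos, fun v => ?_⟩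
    have hv : v = 0 := by
      by_contra hv
      have : ‖v‖⁻¹ • v ∈ Metric.sphere (0 : n → ℝ) 1 := by
        simp [norm_smul, norm_ne_zero_iff.2 hv]
      rw [hempty] at this
      exact this
    have h0 := hsmul 0 0
    rw [hv]
    simp at h0
    simp [h0]
  · obtain ⟨m, hm, hmin⟩ := (isCompact_sphere (0 : n → ℝ) 1).exists_isMinOn hne hF.continuousOn
    refine ⟨F m, hpos m ?_, fun v => ?_⟩
    · rintro rfl
      simp at hm
    · by_cases hv : v = 0
      · have h0 := hsmul 0 0
        simp at h0
        simp [hv, h0]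
      have hv' : ‖v‖ ≠ 0 := norm_ne_zero_iff.2 hv
      have h2 : v = ‖v‖ • (‖v‖⁻¹ • v) := by rw [smul_inv_smul₀ hv']
      have h3 : F m ≤ F (‖v‖⁻¹ • v) := hmin (by simp [norm_smul, hv'])
      have h4 : F v = ‖v‖ ^ 2 * F (‖v‖⁻¹ • v) := by
        conv_lhs => rw [h2]
        rw [hsmul]
      rw [h4, mul_comm]
      gcongr

end QuadraticForms

/-! ### Optimality conditions on the orthogonal group -/

lemma sum_sq_row_of_orthogonal {S : Mat3} (hS : S ∈ Matrix.orthogonalGroup (Fin 3) ℝ)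
    (j : Fin 3) : ∑ k, S j k ^ 2 = 1 := by
  have h := congrFun (congrFun ((Matrix.mem_orthogonalGroup_iff _ _).1 hS) j) j
  simpa [Matrix.mul_apply, pow_two] using h

lemma abs_apply_le_one_of_orthogonal {S : Mat3} (hS : S ∈ Matrix.orthogonalGroup (Fin 3) ℝ)
    (j k : Fin 3) : |S j k| ≤ 1 := by
  rw [← sq_le_one_iff_abs_le_one, ← sum_sq_row_of_orthogonal hS j]
  exact Finset.single_le_sum (f := fun k => S j k ^ 2) (fun _ _ => sq_nonneg _) (Finset.mem_univ k)

/-- The infinitesimal rotation `E_ij - E_ji` in a coordinate plane. -/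
def planeGenerator (i j : Fin 3) : Mat3 := Matrix.single i j 1 - Matrix.single j i 1

/-- The rotation `1 + sin t A + (1 - cos t) A²` by the angle `t` in a coordinate plane, where `A`
is its generator. -/
noncomputable def planeRotation (i j : Fin 3) (t : ℝ) : Mat3 :=
  1 + Real.sin t • planeGenerator i j +
    (1 - Real.cos t) • (planeGenerator i j * planeGenerator i j)

lemma planeRotation_mem {i j : Fin 3} (hij : i ≠ j) (t : ℝ) :
    planeRotation i j t ∈ Matrix.orthogonalGroup (Fin 3) ℝ := by
  rw [Matrix.mem_orthogonalGroup_iff, planeRotation]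
  set A := planeGenerator i j with hA
  have hAt : Aᵀ = -A := by simp [hA, planeGenerator]
  have hA3 : A * A * A = -A := by
    simp only [hA, planeGenerator, mul_sub, sub_mul, neg_sub]
    simp [hij, hij.symm, neg_add_eq_sub]
  have hA4 : A * A * (A * A) = -(A * A) := by
    rw [← mul_assoc, hA3, neg_mul]
  have hc := Real.sin_sq_add_cos_sq t
  set s := Real.sin t
  set c := Real.cos t
  have hT : (1 + s • A + (1 - c) • (A * A))ᵀ = 1 - s • A + (1 - c) • (A * A) := by
    simp [hAt, sub_eq_add_neg]
  rw [hT]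
  have hexp : (1 + s • A + (1 - c) • (A * A)) * (1 - s • A + (1 - c) • (A * A)) =
      1 + (2 * (1 - c) - s ^ 2) • (A * A) + (1 - c) ^ 2 • (A * A * (A * A)) := by
    simp only [add_mul, mul_add, mul_sub, one_mul, mul_one, Matrix.smul_mul, Matrix.mul_smul,
      smul_smul, ← mul_assoc]
    module
  rw [hexp, hA4, smul_neg, ← sub_eq_add_neg, add_sub_assoc, ← sub_smul]
  have h0 : 2 * (1 - c) - s ^ 2 - (1 - c) ^ 2 = 0 := by linarith
  rw [h0, zero_smul, add_zero]

lemma hasDerivAt_planeRotation_mul (i j : Fin 3) (S : Mat3) (k l : Fin 3) :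
    HasDerivAt (fun t => (planeRotation i j t * S) k l) ((planeGenerator i j * S) k l) 0 := by
  simp only [planeRotation, add_mul, Matrix.smul_mul, one_mul, Matrix.add_apply, Matrix.smul_apply,
    smul_eq_mul]
  have h := ((hasDerivAt_const (0 : ℝ) (S k l)).add ((Real.hasDerivAt_sin 0).mul_const
    ((planeGenerator i j * S) k l))).add
    (((hasDerivAt_const (0 : ℝ) (1 : ℝ)).sub (Real.hasDerivAt_cos 0)).mul_const
    ((planeGenerator i j * planeGenerator i j * S) k l))
  refine h.congr_deriv ?_
  simp

/-- The Lagrange multiplier of a critical state: with `G` the block of `Q x` belonging to the matrix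
block `S` of `x`, it is `G Sᵀ`, the only solution `Λ` of `Λ S = G` when `S` is orthogonal. -/
def multiplier (θ : Measurements T) (x : StateIdx → ℝ) : Mat3 :=
  stateMat (costMatrix θ *ᵥ x) * (stateMat x)ᵀ

/-- Stationarity along the plane rotations `P_t S` says that `G Sᵀ` is symmetric. -/
lemma isSymm_multiplier {θ : Measurements T} {x : StateIdx → ℝ}
    (hmin : ∀ P ∈ Matrix.orthogonalGroup (Fin 3) ℝ, x ⬝ᵥ costMatrix θ *ᵥ x ≤
      mkState (stateTr x) (stateScalar x) (P * stateMat x) ⬝ᵥ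
        costMatrix θ *ᵥ mkState (stateTr x) (stateScalar x) (P * stateMat x)) :
    (multiplier θ x).IsSymm := by
  refine Matrix.IsSymm.ext fun i j => ?_
  by_cases hij : i = j
  · rw [hij]
  have h0 : mkState (stateTr x) (stateScalar x) (planeRotation i j 0 * stateMat x) = x := by
    simp [planeRotation]
  have hstat := dotProduct_mulVec_eq_zero_of_forall_le (isSymm_costMatrix θ)
    (φ := fun t => mkState (stateTr x) (stateScalar x) (planeRotation i j t * stateMat x))
    (u := mkState 0 0 (planeGenerator i j * stateMat x))
    (by
      rintro (p | p | ⟨l, k⟩)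
      · exact hasDerivAt_const _ _
      · exact hasDerivAt_const _ _
      · exact hasDerivAt_planeRotation_mul i j (stateMat x) k l)
    (fun t => by
      simp only [h0]
      exact hmin _ (planeRotation_mem hij t))
  simp only [h0] at hstat
  rw [dotProduct_comm, dotProduct_mkState, dotProduct_zero, mul_zero, ← mul_assoc,
    Matrix.trace_mul_comm, ← mul_assoc, planeGenerator, mul_sub, Matrix.trace_sub,
    Matrix.trace_mul_single, Matrix.trace_mul_single] at hstat
  have h1 : multiplier θ x = (stateMat x * (stateMat (costMatrix θ *ᵥ x))ᵀ)ᵀ := by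
    rw [multiplier, Matrix.transpose_mul, Matrix.transpose_transpose]
  rw [h1, Matrix.transpose_apply, Matrix.transpose_apply]
  simp at hstat
  linarith

lemma stateTr_costMatrix_mulVec_eq_zero {θ : Measurements T} {x : StateIdx → ℝ}
    (hmin : ∀ σ : Vec3, x ⬝ᵥ costMatrix θ *ᵥ x ≤
      (x + mkState σ 0 0) ⬝ᵥ costMatrix θ *ᵥ (x + mkState σ 0 0)) :
    stateTr (costMatrix θ *ᵥ x) = 0 := by
  refine dotProduct_eq_zero _ fun σ => ?_
  have hstat := dotProduct_mulVec_eq_zero_of_forall_le (isSymm_costMatrix θ)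
    (φ := fun t : ℝ => x + t • mkState σ 0 0) (u := mkState σ 0 0)
    (fun p => by simpa using ((hasDerivAt_id (0 : ℝ)).mul_const (mkState σ 0 0 p)).const_add (x p))
    (fun t => by simpa [smul_mkState] using hmin (t • σ))
  rw [zero_smul, add_zero, dotProduct_comm, dotProduct_mkState] at hstat
  simpa using hstat

lemma stateScalar_costMatrix_mulVec_eq_zero {θ : Measurements T} {x : StateIdx → ℝ}
    (hmin : ∀ s : ℝ, x ⬝ᵥ costMatrix θ *ᵥ x ≤
      (x + mkState 0 s 0) ⬝ᵥ costMatrix θ *ᵥ (x + mkState 0 s 0)) :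
    stateScalar (costMatrix θ *ᵥ x) = 0 := by
  have hstat := dotProduct_mulVec_eq_zero_of_forall_le (isSymm_costMatrix θ)
    (φ := fun t : ℝ => x + t • mkState 0 1 0) (u := mkState 0 1 0)
    (fun p => by simpa using ((hasDerivAt_id (0 : ℝ)).mul_const (mkState 0 1 0 p)).const_add (x p))
    (fun t => by simpa [smul_mkState] using hmin t)
  rw [zero_smul, add_zero, dotProduct_comm, dotProduct_mkState] at hstat
  simpa using hstat

/-- The dual matrix of either problem annihilates a critical state exactly when `Λ` is the
Lagrange multiplier and the coefficient `c` balances the scalar entry of the gradient. -/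
lemma dualMatrix_mulVec_eq_zero_iff {θ : Measurements T} {x : StateIdx → ℝ}
    (hS : stateMat x ∈ Matrix.orthogonalGroup (Fin 3) ℝ)
    (htr : stateTr (costMatrix θ *ᵥ x) = 0) (c : ℝ) (Λ : Mat3) :
    (costMatrix θ + multiplierMatrix c Λ) *ᵥ x = 0 ↔
      stateScalar (costMatrix θ *ᵥ x) + c * stateScalar x = 0 ∧ Λ = multiplier θ x := by
  have hSS := (Matrix.mem_orthogonalGroup_iff _ _).1 hS
  have hSS' := (Matrix.mem_orthogonalGroup_iff' _ _).1 hS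
  rw [Matrix.add_mulVec, multiplierMatrix_mulVec]
  nth_rw 1 [← mkState_state (costMatrix θ *ᵥ x)]
  rw [mkState_add, htr, add_zero, ← sub_eq_add_neg, multiplier]
  constructor
  · intro h
    have h1 : stateScalar (costMatrix θ *ᵥ x) + c * stateScalar x = 0 := congrArg stateScalar h
    have h2 : stateMat (costMatrix θ *ᵥ x) - Λ * stateMat x = 0 := congrArg stateMat h
    refine ⟨h1, ?_⟩
    rw [sub_eq_zero.1 h2, mul_assoc, hSS, mul_one]
  · rintro ⟨h1, h2⟩
    rw [h1, h2, mul_assoc, hSS', mul_one, sub_self, mkState_zero]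

lemma abs_multiplier_apply_le {θ : Measurements T} {x : StateIdx → ℝ}
    (hS : stateMat x ∈ Matrix.orthogonalGroup (Fin 3) ℝ) {h : ℝ}
    (hle : ∀ p, |(costMatrix θ *ᵥ x) p| ≤ h) (i j : Fin 3) : |multiplier θ x i j| ≤ 3 * h := by
  have h0 : ∀ k, |stateMat (costMatrix θ *ᵥ x) i k * stateMat x j k| ≤ h := by
    intro k
    rw [abs_mul]
    exact (mul_le_of_le_one_right (abs_nonneg _) (abs_apply_le_one_of_orthogonal hS j k)).trans
      (hle _)
  calc |multiplier θ x i j| = |∑ k, stateMat (costMatrix θ *ᵥ x) i k * stateMat x j k| := rfl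
    _ ≤ ∑ k, |stateMat (costMatrix θ *ᵥ x) i k * stateMat x j k| := Finset.abs_sum_le_sum_abs _ _
    _ ≤ ∑ _k : Fin 3, h := Finset.sum_le_sum fun k _ => h0 k
    _ = 3 * h := by simp

/-! ### Measurements near the noise-free ones -/

lemma continuous_costForm : Continuous fun z : Measurements T × (StateIdx → ℝ) =>
    z.2 ⬝ᵥ costMatrix z.1 *ᵥ z.2 := by
  simp only [dotProduct_costMatrix_mulVec]
  simp only [cost, trCost, rotCost, stateMat, stateTr, stateScalar, rotA, rotB, trA, trB,
    Matrix.mul_apply, Matrix.mulVec, dotProduct, Matrix.sub_apply, Pi.sub_apply, Pi.add_apply,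
    Pi.smul_apply, smul_eq_mul, Matrix.of_apply]
  fun_prop

lemma costForm_smul (θ : Measurements T) (a : ℝ) (x : StateIdx → ℝ) :
    (a • x) ⬝ᵥ costMatrix θ *ᵥ (a • x) = a ^ 2 * (x ⬝ᵥ costMatrix θ *ᵥ x) := by
  simp only [Matrix.mulVec_smul, smul_dotProduct, dotProduct_smul, smul_eq_mul]
  ring

/-- A bound for the entries of the gradient `Q x` of every state whose cost is at most that of `b`,
by the Cauchy–Schwarz inequality of the form `Q`. -/
noncomputable def gradientBound (b : StateIdx → ℝ) (θ : Measurements T) : ℝ :=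
  ∑ p, √((Pi.single p 1 ⬝ᵥ costMatrix θ *ᵥ Pi.single p 1) * (b ⬝ᵥ costMatrix θ *ᵥ b))

lemma continuous_gradientBound (b : StateIdx → ℝ) :
    Continuous (gradientBound b : Measurements T → ℝ) := by
  have h : ∀ x : StateIdx → ℝ, Continuous fun θ : Measurements T => x ⬝ᵥ costMatrix θ *ᵥ x :=
    fun x => continuous_costForm.comp (by fun_prop : Continuous fun θ : Measurements T => (θ, x))
  exact continuous_finsetSum _ fun p _ => ((h _).mul (h b)).sqrt

lemma gradientBound_nonneg (b : StateIdx → ℝ) (θ : Measurements T) : 0 ≤ gradientBound b θ :=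
  Finset.sum_nonneg fun _ _ => Real.sqrt_nonneg _

lemma abs_costMatrix_mulVec_le {θ : Measurements T} {b x : StateIdx → ℝ}
    (hx : x ⬝ᵥ costMatrix θ *ᵥ x ≤ b ⬝ᵥ costMatrix θ *ᵥ b) (p : StateIdx) :
    |(costMatrix θ *ᵥ x) p| ≤ gradientBound b θ := by
  have h1 := sq_dotProduct_mulVec_le (posSemidef_costMatrix θ) (Pi.single p 1) x
  rw [single_one_dotProduct] at h1
  have h2 : 0 ≤ Pi.single p 1 ⬝ᵥ costMatrix θ *ᵥ Pi.single p 1 := by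
    rw [dotProduct_costMatrix_mulVec]
    exact cost_nonneg _ _ _ _
  refine (Real.abs_le_sqrt (h1.trans (mul_le_mul_of_nonneg_left hx h2))).trans ?_
  exact Finset.single_le_sum
    (f := fun p => √((Pi.single p 1 ⬝ᵥ costMatrix θ *ᵥ Pi.single p 1) *
      (b ⬝ᵥ costMatrix θ *ᵥ b))) (fun _ _ => Real.sqrt_nonneg _) (Finset.mem_univ p)

/-- The two open conditions on the measurements that the duality theory needs, relative to the
ground truth state `b`. The first makes the primal problems coercive. The second says that the
pencil `Q + diag(0, c, -I ⊗ Λ)` stays positive definite on the hyperplane orthogonal to `b`, for all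
coefficients as small as the multipliers of an optimal state can be; adding `(b ⬝ᵥ v) ^ 2` makes this
a condition on all vectors. The factor `3` is the number of terms in an entry of `G Sᵀ`. -/
structure IsRegular (b : StateIdx → ℝ) (θ : Measurements T) : Prop where
  coercive : ∀ v, v ≠ 0 → 0 < v ⬝ᵥ costMatrix θ *ᵥ v + (stateMat v * (stateMat v)ᵀ).trace
  pencil_pos : ∀ (c : ℝ) (Λ : Mat3), |c| ≤ 3 * gradientBound b θ →
    (∀ i j, |Λ i j| ≤ 3 * gradientBound b θ) →
    ∀ v, v ≠ 0 → 0 < v ⬝ᵥ (costMatrix θ + multiplierMatrix c Λ) *ᵥ v + (b ⬝ᵥ v) ^ 2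

lemma trace_mul_transpose_nonneg (S : Mat3) : 0 ≤ (S * Sᵀ).trace := by
  rw [← Matrix.conjTranspose_eq_transpose_of_trivial]
  exact (Matrix.posSemidef_self_mul_conjTranspose S).trace_nonneg

lemma continuous_trace_stateMat :
    Continuous fun v : StateIdx → ℝ => (stateMat v * (stateMat v)ᵀ).trace := by
  simp only [stateMat, Matrix.trace, Matrix.diag, Matrix.mul_apply, Matrix.transpose_apply,
    Matrix.of_apply]
  fun_prop

lemma trace_stateMat_smul (a : ℝ) (v : StateIdx → ℝ) :
    (stateMat (a • v) * (stateMat (a • v))ᵀ).trace =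
      a ^ 2 * (stateMat v * (stateMat v)ᵀ).trace := by
  rw [stateMat_smul, Matrix.transpose_smul, Matrix.smul_mul, Matrix.mul_smul, smul_smul,
    Matrix.trace_smul, smul_eq_mul, pow_two]

/-- If the cost form of `θbar` vanishes only on the line through `b`, then all measurements near
`θbar` are regular: at `θbar` the bound on the multipliers is zero, and both forms are positive
definite. -/
lemma eventually_isRegular {θbar : Measurements T} {b : StateIdx → ℝ}
    (hb : stateMat b ≠ 0) (hb0 : b ⬝ᵥ costMatrix θbar *ᵥ b = 0)
    (hker : ∀ v, v ⬝ᵥ costMatrix θbar *ᵥ v = 0 → ∃ a : ℝ, v = a • b) :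
    ∀ᶠ θ in 𝓝 θbar, IsRegular b θ := by
  have hnonneg : ∀ v, 0 ≤ v ⬝ᵥ costMatrix θbar *ᵥ v := by
    intro v
    rw [dotProduct_costMatrix_mulVec]
    exact cost_nonneg _ _ _ _
  have hcoer : ∀ᶠ θ in 𝓝 θbar, ∀ v, v ≠ 0 →
      0 < v ⬝ᵥ costMatrix θ *ᵥ v + (stateMat v * (stateMat v)ᵀ).trace := by
    refine eventually_forall_pos (F := fun θ v => v ⬝ᵥ costMatrix θ *ᵥ v +
      (stateMat v * (stateMat v)ᵀ).trace) ?_ ?_ ?_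
    · exact continuous_costForm.add (continuous_trace_stateMat.comp continuous_snd)
    · intro θ a v
      rw [costForm_smul, trace_stateMat_smul, mul_add]
    · intro v hv
      refine lt_of_le_of_ne (add_nonneg (hnonneg v) (trace_mul_transpose_nonneg _)) fun h0 => hv ?_
      have h1 := hnonneg v
      have h2 := trace_mul_transpose_nonneg (stateMat v)
      obtain ⟨a, rfl⟩ := hker v (by linarith)
      have h3 : (stateMat (a • b) * (stateMat (a • b))ᴴ).trace = 0 := by
        rw [Matrix.conjTranspose_eq_transpose_of_trivial]
        linarith
      rw [Matrix.trace_mul_conjTranspose_self_eq_zero_iff, stateMat_smul] at h3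
      rw [(smul_eq_zero.1 h3).resolve_right hb, zero_smul]
  have hform : ∀ (θ : Measurements T) (c : ℝ) (Λ : Mat3) (v : StateIdx → ℝ),
      v ⬝ᵥ (costMatrix θ + multiplierMatrix c Λ) *ᵥ v + (b ⬝ᵥ v) ^ 2 =
        v ⬝ᵥ costMatrix θ *ᵥ v + (c * stateScalar v ^ 2 -
          (Λ * (stateMat v * (stateMat v)ᵀ)).trace) + (b ⬝ᵥ v) ^ 2 := by
    intro θ c Λ v
    rw [Matrix.add_mulVec, dotProduct_add, dotProduct_multiplierMatrix_mulVec]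
  have hpencil : ∀ᶠ z : Measurements T × ℝ × (Fin 3 → Fin 3 → ℝ) in 𝓝 (θbar, 0, 0), ∀ v, v ≠ 0 →
      0 < v ⬝ᵥ (costMatrix z.1 + multiplierMatrix z.2.1 (Matrix.of z.2.2)) *ᵥ v +
        (b ⬝ᵥ v) ^ 2 := by
    refine eventually_forall_pos (F := fun (z : Measurements T × ℝ × (Fin 3 → Fin 3 → ℝ)) v =>
      v ⬝ᵥ (costMatrix z.1 + multiplierMatrix z.2.1 (Matrix.of z.2.2)) *ᵥ v +
        (b ⬝ᵥ v) ^ 2) ?_ ?_ ?_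
    · simp only [hform]
      refine ((continuous_costForm.comp (by fun_prop :
        Continuous fun p : (Measurements T × ℝ × (Fin 3 → Fin 3 → ℝ)) × (StateIdx → ℝ) =>
          (p.1.1, p.2))).add ?_).add ?_
      · simp only [stateMat, stateScalar, Matrix.trace, Matrix.diag, Matrix.mul_apply,
          Matrix.transpose_apply, Matrix.of_apply]
        fun_prop
      · simp only [dotProduct]
        fun_prop
    · intro z a v
      simp only [Matrix.mulVec_smul, smul_dotProduct, dotProduct_smul, smul_eq_mul]
      ring
    · intro v hv
      simp only [hform]
      have h1 := hnonneg v
      have h2 := sq_nonneg (b ⬝ᵥ v)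
      rw [show Matrix.of (0 : Fin 3 → Fin 3 → ℝ) = 0 from rfl, zero_mul, zero_mul,
        Matrix.trace_zero, sub_self, add_zero]
      refine lt_of_le_of_ne (add_nonneg h1 h2) fun h0 => hv ?_
      obtain ⟨a, rfl⟩ := hker v (by linarith)
      have h3 : b ⬝ᵥ (a • b) = 0 := pow_eq_zero_iff two_ne_zero |>.1 (by linarith)
      rw [dotProduct_smul, smul_eq_mul, mul_eq_zero] at h3
      rcases h3 with h3 | h3
      · rw [h3, zero_smul]
      · rw [dotProduct_self_eq_zero.1 h3, smul_zero]
  obtain ⟨ε, hε, hball⟩ := Metric.eventually_nhds_iff.1 hpencil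
  have hgrad0 : gradientBound b θbar = 0 := by simp [gradientBound, hb0]
  have hgrad : ∀ᶠ θ in 𝓝 θbar, 3 * gradientBound b θ < ε := by
    refine (continuous_const.mul (continuous_gradientBound b)).continuousAt.eventually_lt_const ?_
    simpa [hgrad0] using hε
  filter_upwards [hcoer, hgrad, Metric.ball_mem_nhds θbar hε] with θ h1 h2 h3
  refine ⟨h1, fun c Λ hc hΛ => hball (y := (θ, c, Λ)) ?_⟩
  rw [Prod.dist_eq, Prod.dist_eq, max_lt_iff, max_lt_iff]
  refine ⟨h3, ?_, ?_⟩
  · rw [Real.dist_eq, sub_zero]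
    exact hc.trans_lt h2
  · refine (dist_pi_lt_iff hε).2 fun i => (dist_pi_lt_iff hε).2 fun j => ?_
    rw [Real.dist_eq]
    simpa using (hΛ i j).trans_lt h2

/-! ### Strong duality and recovery for regular measurements -/

lemma trace_mul_transpose_of_orthogonal {S : Mat3}
    (hS : S ∈ Matrix.orthogonalGroup (Fin 3) ℝ) : (S * Sᵀ).trace = 3 := by
  rw [(Matrix.mem_orthogonalGroup_iff _ _).1 hS]
  simp

/-- The states of the unknown-scale problem. -/
def unknownStates : Set (StateIdx → ℝ) := {x | stateMat x ∈ Matrix.orthogonalGroup (Fin 3) ℝ}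

/-- The states of the known-scale problem. -/
def knownStates : Set (StateIdx → ℝ) := unknownStates ∩ {x | stateScalar x = 1}

lemma isClosed_unknownStates : IsClosed unknownStates := by
  have h : unknownStates = {x : StateIdx → ℝ | ∀ i j, (stateMat x * (stateMat x)ᵀ) i j =
      (1 : Mat3) i j} := by
    ext x
    rw [unknownStates, Set.mem_ofPred_eq, Matrix.mem_orthogonalGroup_iff]
    exact ⟨fun h i j => congrFun (congrFun h i) j, fun h => Matrix.ext h⟩
  rw [h]
  simp only [Set.ofPred_forall]
  refine isClosed_iInter fun i => isClosed_iInter fun j => isClosed_eq ?_ continuous_const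
  simp only [stateMat, Matrix.mul_apply, Matrix.transpose_apply, Matrix.of_apply]
  fun_prop

lemma isClosed_knownStates : IsClosed knownStates :=
  isClosed_unknownStates.inter (isClosed_eq (continuous_apply _) continuous_const)

lemma exists_minimizer {b : StateIdx → ℝ} {θ : Measurements T} (hθ : IsRegular b θ)
    {C : Set (StateIdx → ℝ)} (hC : IsClosed C) (hCO : C ⊆ unknownStates) (hb : b ∈ C) :
    ∃ x ∈ C, ∀ x' ∈ C, x ⬝ᵥ costMatrix θ *ᵥ x ≤ x' ⬝ᵥ costMatrix θ *ᵥ x' := by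
  have hcost : Continuous fun v : StateIdx → ℝ => v ⬝ᵥ costMatrix θ *ᵥ v :=
    continuous_costForm.comp (by fun_prop : Continuous fun v : StateIdx → ℝ => (θ, v))
  obtain ⟨μ, hμ, hle⟩ := exists_mul_sq_norm_le
    (F := fun v => v ⬝ᵥ costMatrix θ *ᵥ v + (stateMat v * (stateMat v)ᵀ).trace)
    (hcost.add continuous_trace_stateMat)
    (fun a v => by rw [costForm_smul, trace_stateMat_smul, mul_add]) hθ.coercive
  set K := C ∩ {v | v ⬝ᵥ costMatrix θ *ᵥ v ≤ b ⬝ᵥ costMatrix θ *ᵥ b}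
  have hKc : IsCompact K := by
    refine Metric.isCompact_of_isClosed_isBounded
      (hC.inter (isClosed_le hcost continuous_const)) ?_
    refine (Metric.isBounded_closedBall (x := 0)
      (r := √((b ⬝ᵥ costMatrix θ *ᵥ b + 3) / μ))).subset fun v hv => ?_
    rw [mem_closedBall_zero_iff]
    refine Real.le_sqrt_of_sq_le ?_
    rw [le_div_iff₀ hμ, mul_comm]
    refine (hle v).trans ?_
    rw [trace_mul_transpose_of_orthogonal (hCO hv.1)]
    exact add_le_add_left hv.2 3
  obtain ⟨x, hx, hmin⟩ := hKc.exists_isMinOn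
    ⟨b, hb, le_refl (b ⬝ᵥ costMatrix θ *ᵥ b)⟩ hcost.continuousOn
  refine ⟨x, hx.1, fun x' hx' => ?_⟩
  by_cases h : x' ⬝ᵥ costMatrix θ *ᵥ x' ≤ b ⬝ᵥ costMatrix θ *ᵥ b
  · exact hmin ⟨hx', h⟩
  · exact hx.2.trans (not_le.1 h).le

/-- At a state whose cost is at most that of the ground truth, the multipliers are small, so
regularity makes the dual matrix they define positive semidefinite with a one-dimensional kernel. -/
lemma posSemidef_pencil {b : StateIdx → ℝ} {θ : Measurements T} (hθ : IsRegular b θ)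
    {x : StateIdx → ℝ} (hS : x ∈ unknownStates)
    (hle : x ⬝ᵥ costMatrix θ *ᵥ x ≤ b ⬝ᵥ costMatrix θ *ᵥ b)
    (hsymm : (multiplier θ x).IsSymm) {c : ℝ} (hc : |c| ≤ gradientBound b θ)
    (hx : (costMatrix θ + multiplierMatrix c (multiplier θ x)) *ᵥ x = 0) :
    (costMatrix θ + multiplierMatrix c (multiplier θ x)).PosSemidef ∧
      ∀ v, (costMatrix θ + multiplierMatrix c (multiplier θ x)) *ᵥ v = 0 → ∃ a : ℝ, v = a • x := by
  refine posSemidef_of_pos_add_sq ((isSymm_costMatrix θ).add (isSymm_multiplierMatrix hsymm)) ?_ hx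
    (hθ.pencil_pos c _ ?_ fun i j =>
      abs_multiplier_apply_le hS (abs_costMatrix_mulVec_le hle) i j)
  · rintro rfl
    have h := trace_mul_transpose_of_orthogonal hS
    rw [show stateMat 0 = 0 from rfl, zero_mul, Matrix.trace_zero] at h
    norm_num at h
  · linarith [gradientBound_nonneg b θ]

lemma isSymm_multiplier_of_minimizer {θ : Measurements T} {x : StateIdx → ℝ}
    (hx : x ∈ unknownStates)
    (hmin : ∀ x' ∈ unknownStates, stateScalar x' = stateScalar x →
      x ⬝ᵥ costMatrix θ *ᵥ x ≤ x' ⬝ᵥ costMatrix θ *ᵥ x') :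
    (multiplier θ x).IsSymm :=
  isSymm_multiplier fun P hP => hmin (mkState (stateTr x) (stateScalar x) (P * stateMat x))
    (mul_mem hP hx) rfl

lemma stateTr_gradient_of_minimizer {θ : Measurements T} {x : StateIdx → ℝ}
    (hx : x ∈ unknownStates)
    (hmin : ∀ x' ∈ unknownStates, stateScalar x' = stateScalar x →
      x ⬝ᵥ costMatrix θ *ᵥ x ≤ x' ⬝ᵥ costMatrix θ *ᵥ x') :
    stateTr (costMatrix θ *ᵥ x) = 0 := by
  refine stateTr_costMatrix_mulVec_eq_zero fun σ => ?_
  have h : x + mkState σ 0 0 = mkState (stateTr x + σ) (stateScalar x) (stateMat x) := by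
    nth_rw 1 [← mkState_state x]
    rw [mkState_add, add_zero, add_zero]
  rw [h]
  exact hmin _ hx rfl

/-- On a state with orthogonal matrix block, the dual form is the cost minus the dual value. -/
lemma dotProduct_dualMatrix_mulVec {θ : Measurements T} {x : StateIdx → ℝ}
    (hx : x ∈ unknownStates) (c : ℝ) (Λ : Mat3) :
    x ⬝ᵥ (costMatrix θ + multiplierMatrix c Λ) *ᵥ x =
      x ⬝ᵥ costMatrix θ *ᵥ x + c * stateScalar x ^ 2 - Λ.trace := by
  rw [Matrix.add_mulVec, dotProduct_add, dotProduct_multiplierMatrix_mulVec,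
    (Matrix.mem_orthogonalGroup_iff _ _).1 hx, mul_one, add_sub_assoc]

lemma isOptimalKnown_of_forall {θ : Measurements T} {x : StateIdx → ℝ} (hx : x ∈ knownStates)
    (hmin : ∀ x' ∈ knownStates, x ⬝ᵥ costMatrix θ *ᵥ x ≤ x' ⬝ᵥ costMatrix θ *ᵥ x') :
    IsOptimalKnown θ (stateMat x) (stateTr x) := by
  refine ⟨hx.1, fun R' hR' τ' => ?_⟩
  have h := hmin (mkState τ' 1 R') ⟨hR', rfl⟩
  rwa [dotProduct_costMatrix_mulVec, dotProduct_costMatrix_mulVec, hx.2] at h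

lemma isOptimalUnknown_of_forall {θ : Measurements T} {x : StateIdx → ℝ} (hx : x ∈ unknownStates)
    (hmin : ∀ x' ∈ unknownStates, x ⬝ᵥ costMatrix θ *ᵥ x ≤ x' ⬝ᵥ costMatrix θ *ᵥ x') :
    IsOptimalUnknown θ (stateMat x) (stateTr x) (stateScalar x) := by
  refine ⟨hx, fun R' hR' τ' α' => ?_⟩
  have h := hmin (mkState τ' α' R') hR'
  rwa [dotProduct_costMatrix_mulVec, dotProduct_costMatrix_mulVec] at h

/-- The multipliers of the primal optimum are dual feasible with the primal value. By complementary
slackness every dual optimum annihilates the primal optimum, hence has the same dual matrix. -/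
theorem strongDuality_and_recovery_known {b : StateIdx → ℝ} {θ : Measurements T}
    (hθ : IsRegular b θ) (hb : b ∈ knownStates) : StrongDualityKnown θ ∧ RecoveryKnown θ := by
  obtain ⟨x, hx, hmin⟩ := exists_minimizer hθ isClosed_knownStates Set.inter_subset_left hb
  have hmin' : ∀ x' ∈ unknownStates, stateScalar x' = stateScalar x →
      x ⬝ᵥ costMatrix θ *ᵥ x ≤ x' ⬝ᵥ costMatrix θ *ᵥ x' :=
    fun x' hx' hs => hmin x' ⟨hx', hs.trans hx.2⟩
  have hopt := isOptimalKnown_of_forall hx hmin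
  have htr := stateTr_gradient_of_minimizer hx.1 hmin'
  have hsymm := isSymm_multiplier_of_minimizer hx.1 hmin'
  have hs : stateScalar x = 1 := hx.2
  set c := -stateScalar (costMatrix θ *ᵥ x) with hc
  have hnull : (costMatrix θ + multiplierMatrix c (multiplier θ x)) *ᵥ x = 0 :=
    (dualMatrix_mulVec_eq_zero_iff hx.1 htr _ _).2 ⟨by rw [hs, mul_one, hc, add_neg_cancel], rfl⟩
  obtain ⟨hpsd, hker⟩ := posSemidef_pencil hθ hx.1 (hmin b hb) hsymm
    (by rw [hc, abs_neg]; exact abs_costMatrix_mulVec_le (hmin b hb) _) hnull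
  set γ := (multiplier θ x).trace - c with hγ
  have hZ : dualMatrixKnown θ γ (multiplier θ x) =
      costMatrix θ + multiplierMatrix c (multiplier θ x) := by
    rw [dualMatrixKnown, hγ, sub_sub_cancel]
  have hfeas : IsDualFeasibleKnown θ γ (multiplier θ x) := ⟨hsymm, by rwa [hZ]⟩
  have hval : ∀ γ' Λ', x ⬝ᵥ dualMatrixKnown θ γ' Λ' *ᵥ x = x ⬝ᵥ costMatrix θ *ᵥ x - γ' := by
    intro γ' Λ'
    rw [dualMatrixKnown, dotProduct_dualMatrix_mulVec hx.1, hs]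
    ring
  have hγval : γ = x ⬝ᵥ costMatrix θ *ᵥ x := by
    have h := hval γ (multiplier θ x)
    rw [hZ, hnull, dotProduct_zero] at h
    linarith
  have hweak : ∀ γ' Λ', IsDualFeasibleKnown θ γ' Λ' → γ' ≤ γ := by
    intro γ' Λ' h
    have h1 := h.2.dotProduct_mulVec_nonneg x
    rw [star_trivial, hval] at h1
    linarith
  refine ⟨⟨_, _, γ, multiplier θ x, hopt, ⟨hfeas, hweak⟩, ?_⟩, fun γ' Λ' h => ?_⟩
  · rw [hγval, dotProduct_costMatrix_mulVec, hs]
  have hγ' : γ' = γ := le_antisymm (hweak _ _ h.1) (h.2 _ _ hfeas)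
  have hnull' : dualMatrixKnown θ γ' Λ' *ᵥ x = 0 := by
    rw [← h.1.2.dotProduct_mulVec_zero_iff, star_trivial, hval, hγ', hγval, sub_self]
  have hΛ' : Λ' = multiplier θ x := ((dualMatrix_mulVec_eq_zero_iff hx.1 htr _ _).1 hnull').2
  subst hγ' hΛ'
  refine ⟨⟨x, ?_, hnull'⟩, fun v hv hv0 => ?_⟩
  · rintro rfl
    exact zero_ne_one hs
  rw [hZ] at hv0
  obtain ⟨a, rfl⟩ := hker v hv0
  have ha : a ≠ 0 := by
    rintro rfl
    exact hv (zero_smul _ _)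
  rw [stateScalar_smul, hs, mul_one, stateMat_smul, stateTr_smul, inv_smul_smul₀ ha,
    inv_smul_smul₀ ha]
  exact ⟨ha, hopt⟩

/-- The argument is the one for known scale; the null line contains the optimal state only up to
sign, and the cost and the orthogonal group are invariant under `x ↦ -x`. -/
theorem strongDuality_and_recovery_unknown {b : StateIdx → ℝ} {θ : Measurements T}
    (hθ : IsRegular b θ) (hb : b ∈ unknownStates) :
    StrongDualityUnknown θ ∧ RecoveryUnknown θ := by
  obtain ⟨x, hx, hmin⟩ := exists_minimizer hθ isClosed_unknownStates subset_rfl hb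
  have hmin' : ∀ x' ∈ unknownStates, stateScalar x' = stateScalar x →
      x ⬝ᵥ costMatrix θ *ᵥ x ≤ x' ⬝ᵥ costMatrix θ *ᵥ x' := fun x' hx' _ => hmin x' hx'
  have hopt := isOptimalUnknown_of_forall hx hmin
  have htr := stateTr_gradient_of_minimizer hx hmin'
  have hsymm := isSymm_multiplier_of_minimizer hx hmin'
  have hsc : stateScalar (costMatrix θ *ᵥ x) = 0 := by
    refine stateScalar_costMatrix_mulVec_eq_zero fun s => ?_
    have h : x + mkState 0 s 0 = mkState (stateTr x) (stateScalar x + s) (stateMat x) := by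
      nth_rw 1 [← mkState_state x]
      rw [mkState_add, add_zero, add_zero]
    rw [h]
    exact hmin _ hx
  have hnull : dualMatrixUnknown θ (multiplier θ x) *ᵥ x = 0 :=
    (dualMatrix_mulVec_eq_zero_iff hx htr _ _).2 ⟨by rw [hsc, zero_mul, add_zero], rfl⟩
  obtain ⟨hpsd, hker⟩ := posSemidef_pencil hθ hx (hmin b hb) hsymm
    (by rw [abs_zero]; exact gradientBound_nonneg b θ) hnull
  have hfeas : IsDualFeasibleUnknown θ (multiplier θ x) := ⟨hsymm, hpsd⟩
  have hval : ∀ Λ', x ⬝ᵥ dualMatrixUnknown θ Λ' *ᵥ x = x ⬝ᵥ costMatrix θ *ᵥ x - Λ'.trace := by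
    intro Λ'
    rw [dualMatrixUnknown, dotProduct_dualMatrix_mulVec hx, zero_mul, add_zero]
  have htrace : (multiplier θ x).trace = x ⬝ᵥ costMatrix θ *ᵥ x := by
    have h := hval (multiplier θ x)
    rw [hnull, dotProduct_zero] at h
    linarith
  have hweak : ∀ Λ', IsDualFeasibleUnknown θ Λ' → Λ'.trace ≤ (multiplier θ x).trace := by
    intro Λ' h
    have h1 := h.2.dotProduct_mulVec_nonneg x
    rw [star_trivial, hval] at h1
    linarith
  refine ⟨⟨_, _, _, multiplier θ x, hopt, ⟨hfeas, hweak⟩, ?_⟩, fun Λ' h => ?_⟩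
  · rw [htrace, dotProduct_costMatrix_mulVec]
  have htrace' : Λ'.trace = (multiplier θ x).trace := le_antisymm (hweak _ h.1) (h.2 _ hfeas)
  have hnull' : dualMatrixUnknown θ Λ' *ᵥ x = 0 := by
    rw [← h.1.2.dotProduct_mulVec_zero_iff, star_trivial, hval, htrace', htrace, sub_self]
  have hΛ' : Λ' = multiplier θ x := ((dualMatrix_mulVec_eq_zero_iff hx htr _ _).1 hnull').2
  subst hΛ'
  have hx0 : x ≠ 0 := by
    rintro rfl
    have h3 := trace_mul_transpose_of_orthogonal hx
    rw [show stateMat 0 = 0 from rfl, zero_mul, Matrix.trace_zero] at h3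
    norm_num at h3
  refine ⟨finrank_eq_one_iff'.2 ⟨⟨x, hnull⟩, ?_, ?_⟩, fun v hv hv0 => ?_⟩
  · exact fun h0 => hx0 (congrArg Subtype.val h0)
  · rintro ⟨v, hv⟩
    obtain ⟨a, rfl⟩ := hker v hv
    exact ⟨a, rfl⟩
  obtain ⟨a, rfl⟩ := hker v hv0
  have ha : a ≠ 0 := by
    rintro rfl
    exact hv (zero_smul _ _)
  have hneg : -x ∈ unknownStates := by
    change -stateMat x ∈ Matrix.orthogonalGroup (Fin 3) ℝ
    rw [Matrix.mem_orthogonalGroup_iff, Matrix.transpose_neg, neg_mul_neg]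
    exact (Matrix.mem_orthogonalGroup_iff _ _).1 hx
  have hoptneg := isOptimalUnknown_of_forall (θ := θ) hneg fun x' hx' => by
    rw [Matrix.mulVec_neg, neg_dotProduct_neg]
    exact hmin x' hx'
  refine ⟨|a|, abs_pos.2 ha, ?_⟩
  have hcases : |a|⁻¹ • (a • x) = x ∨ |a|⁻¹ • (a • x) = -x := by
    rcases abs_choice a with h1 | h1
    · left
      rw [h1, inv_smul_smul₀ ha]
    · right
      rw [h1, inv_neg, neg_smul, inv_smul_smul₀ ha]
  rw [← stateMat_smul, ← stateTr_smul, ← stateScalar_smul]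
  rcases hcases with h1 | h1
  · rw [h1]
    exact hopt
  · rw [h1]
    exact hoptneg

end HandEye

theorem mainTheorem1 {T : ℕ} (θbar : HandEye.Measurements T)
    (R : HandEye.Mat3) (τ : HandEye.Vec3) (hfree : HandEye.IsNoiseFree θbar R τ)
    (i j : Fin T)
    (hi : HandEye.rotB θbar i ≠ 1) (hj : HandEye.rotB θbar j ≠ 1)
    (haxes : HandEye.axis (HandEye.rotB θbar i) ≠ HandEye.axis (HandEye.rotB θbar j))
    (hhalf : ¬ (HandEye.IsHalfTurn (HandEye.rotB θbar i) ∧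
      HandEye.IsHalfTurn (HandEye.rotB θbar j)))
    (hperp : HandEye.IsHalfTurn (HandEye.rotB θbar i) ∨
      HandEye.IsHalfTurn (HandEye.rotB θbar j) →
        ¬ HandEye.PerpendicularAxes (HandEye.rotB θbar i) (HandEye.rotB θbar j))
    (hspan : HandEye.SpanCondition θbar R i j) :
    ∃ ε : ℝ, 0 < ε ∧ ∀ θ : HandEye.Measurements T, ‖θ - θbar‖ ≤ ε →
      (HandEye.StrongDualityKnown θ ∧ HandEye.RecoveryKnown θ) ∧
      (HandEye.StrongDualityUnknown θ ∧ HandEye.RecoveryUnknown θ) := by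
  have hRO : R ∈ Matrix.orthogonalGroup (Fin 3) ℝ :=
    (Matrix.mem_specialOrthogonalGroup_iff.1 hfree.rot_mem).1
  have hR0 : R ≠ 0 := by
    rintro rfl
    have h := HandEye.trace_mul_transpose_of_orthogonal hRO
    rw [zero_mul, Matrix.trace_zero] at h
    norm_num at h
  have hb : HandEye.mkState τ 1 R ∈ HandEye.knownStates := ⟨hRO, rfl⟩
  have hreg : ∀ᶠ θ in nhds θbar, HandEye.IsRegular (HandEye.mkState τ 1 R) θ := by
    refine HandEye.eventually_isRegular hR0 ?_ fun v hv => ⟨HandEye.stateScalar v, ?_⟩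
    · rw [HandEye.dotProduct_costMatrix_mulVec]
      exact HandEye.cost_groundTruth hfree
    · rw [HandEye.dotProduct_costMatrix_mulVec] at hv
      obtain ⟨h1, h2⟩ := HandEye.eq_smul_of_cost_eq_zero hfree hi hj haxes hhalf hperp hspan hv
      rw [HandEye.smul_mkState, ← h1, ← h2, mul_one, HandEye.mkState_state]
  obtain ⟨ε, hε, hball⟩ := Metric.eventually_nhds_iff.1 hreg
  refine ⟨ε / 2, half_pos hε, fun θ hθ => ?_⟩
  have h := hball (y := θ) (by rw [dist_eq_norm]; linarith)
  exact ⟨HandEye.strongDuality_and_recovery_known h hb,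
    HandEye.strongDuality_and_recovery_unknown h hb.1⟩
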